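/- Let $d\ge 1$ be an integer, let $\delta>0$ and $0<\epsilon<1$. There is a quantum algorithm, depending only on $d,\delta,\epsilon$, with the following properties. Let $\mathcal H$ be a complex Hilbert space, let $|\phi\rangle\in\mathcal H$ be an (unknown) unit vector, put $P=|\phi\rangle\langle\phi|$, and let $\{E_1,\dots,E_d\}$ be a POVM on $\mathcal H$. The algorithm is given - a single copy of $|\phi\rangle$; - a coherent measurement oracle for $P$, i.e. the operation $P\otimes\mathbb I+(\mathbb I-P)\otimes\sigma_x$ on $\mathcal H$ and a single ancilla qubit; - a coherent implementation of the POVM, i.e. a unitary $U$ on $\mathcal H\otimes\mathbb C^d$, and its inverse, such that applying $U$ to $|\chi\rangle|1\rangle$ and then measuring the second register in the standard basis gives outcome $i$ with probability $\langle\chi|E_i|\chi\rangle$, for every unit vector $|\chi\rangle$ (for example $U|\chi\rangle|1\rangle=\sum_{i=1}^d(\sqrt{E_i}|\chi\rangle)|i\rangle$). With probability $1$ the algorithm halts and returns an undamaged copy of $|\phi\rangle$ (the register $\mathcal H$ is exactly in the state $|\phi\rangle$, in a product state with everything else). It also outputs real numbers $q_1^{\mathrm{est}},\dots,q_d^{\mathrm{est}}$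 such that, with probability at least $1-\epsilon$, $$|q_i^{\mathrm{est}}-\langle\phi|E_i|\phi\rangle|<\delta\qquad\text{for all } i\in\{1,\dots,d\}.$$ The expected total number of calls to the measurement oracle, to $U$ and to $U^{-1}$ is $O\!\left(\frac d\delta\log\frac d\epsilon\right)$, with an absolute constant. The algorithm is efficient: the size of its program (a quantum circuit with classically controlled branching and loops), including the numbers of qubits and classical bits that it uses, and the expected number of its elementary steps (gates, measurements, classical bit operations and calls) are bounded by a fixed polynomial in $d$, $1/\delta$ and $\log(1/\epsilon)$. -/

import Mathlib

noncomputable section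

open scoped ENNReal

namespace QTomo

/-- The Hilbert space `H ⊗ ℂ^d`: the register `A` with state space `H`, which holds the unknown
state, next to the `d`-level register `B` of the measuring device.  The component `v i` is the
vector of `A` that stands next to the basis state `|i⟩` of `B`. -/
abbrev Joint (H : Type*) (d : ℕ) [NormedAddCommGroup H] : Type _ :=
  PiLp 2 (fun _ : Fin d => H)

/-- (Unnormalised) joint states of `A`, `B` and `w` work qubits: `v x` is the vector of `A ⊗ B`
that stands next to the basis state `|x⟩` of the qubits. -/
abbrev QState (H : Type*) (d w : ℕ) [NormedAddCommGroup H] : Type _ :=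
  (Fin w → Bool) → Joint H d

section Measurements

variable {H : Type*} [NormedAddCommGroup H] [InnerProductSpace ℂ H] {d : ℕ}

/-- `χ ⊗ |first⟩`: register `B` is in its first basis state, written `0 : Fin d`. -/
def withFirst [NeZero d] (χ : H) : Joint H d :=
  WithLp.toLp 2 (Pi.single (0 : Fin d) χ)

/-- `E` is a POVM with `d` outcomes on `H`. -/
structure IsPOVM [CompleteSpace H] (E : Fin d → H →L[ℂ] H) : Prop where
  isPositive : ∀ i, (E i).IsPositive
  sum_eq_one : ∑ i, E i = 1

/-- `⟨φ|E_i|φ⟩`. -/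
def outcomeProb (E : Fin d → H →L[ℂ] H) (φ : H) (i : Fin d) : ℝ :=
  (inner ℂ φ (E i φ)).re

/-- The unitary `U` on `A ⊗ B` is a coherent implementation of `E`: if it is applied to
`χ ⊗ |first⟩` and `B` is then measured in its standard basis, outcome `i` appears with
probability `⟨χ|E_i|χ⟩`.  The unitaries with `U (χ ⊗ |first⟩) = ∑ i, (√E_i χ) ⊗ |i⟩` are of this
kind. -/
def Implements [NeZero d] (U : Joint H d ≃ₗᵢ[ℂ] Joint H d) (E : Fin d → H →L[ℂ] H) : Prop :=
  ∀ (χ : H) (i : Fin d), ‖U (withFirst χ) i‖ ^ 2 = outcomeProb E χ i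

/-- The projector `P = |φ⟩⟨φ|` (for a unit vector `φ`). -/
def proj (φ χ : H) : H := (inner ℂ φ χ : ℂ) • φ

end Measurements

/-- Programs for a quantum computer with classical control: register `A` (a black box, accessible
only through the two oracles), the `d`-level register `B`, `w` work qubits, `c` classical bits. -/
inductive Prog (d w c : ℕ) : Type
  | skip : Prog d w c
  /-- The one-qubit unitary `G` on qubit `q`, controlled by the listed qubits having the listed
  values and, if `lab = some i`, by `B` being in the state `|i⟩`. -/
  | gate (lab : Option (Fin d)) (ctrl : List (Fin w × Bool)) (G : Matrix.unitaryGroup Bool ℂ)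
      (q : Fin w) (hq : ∀ p ∈ ctrl, p.1 ≠ q) : Prog d w c
  /-- The coherent measurement `P ⊗ 𝕀 + (1 - P) ⊗ σₓ` on `A` and qubit `q`. -/
  | oracle (q : Fin w) : Prog d w c
  /-- The unitary `U` that implements the POVM, on `A` and `B`. -/
  | povm : Prog d w c
  /-- The inverse of that unitary. -/
  | povmInv : Prog d w c
  /-- Measure qubit `q` in the standard basis and write the outcome to the bit `k`. -/
  | meas (q : Fin w) (k : Fin c) : Prog d w c
  /-- The classical gate `k := f i j`. -/
  | assign (k : Fin c) (f : Bool → Bool → Bool) (i j : Fin c) : Prog d w c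
  | seq (p₁ p₂ : Prog d w c) : Prog d w c
  /-- Run `p₁` if the bit `k` is set, and `p₂` otherwise. -/
  | ite (k : Fin c) (p₁ p₂ : Prog d w c) : Prog d w c
  /-- Run `body` as long as the bit `k` is set. -/
  | while (k : Fin c) (body : Prog d w c) : Prog d w c

/-- The cost of a controlled gate: one, plus one for every bit that controls it (the control by
`B` looks at `⌈log₂ d⌉` bits). -/
def gateCost {d w : ℕ} (lab : Option (Fin d)) (ctrl : List (Fin w × Bool)) : ℕ :=
  1 + ctrl.length + (if lab.isSome then Nat.clog 2 d else 0)

/-- The length of the program text. -/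
def Prog.size {d w c : ℕ} : Prog d w c → ℕ
  | .skip => 1
  | .gate lab ctrl _ _ _ => gateCost lab ctrl
  | .oracle _ => 1
  | .povm => 1
  | .povmInv => 1
  | .meas _ _ => 1
  | .assign _ _ _ _ => 1
  | .seq p₁ p₂ => p₁.size + p₂.size + 1
  | .ite _ p₁ p₂ => p₁.size + p₂.size + 1
  | .while _ body => body.size + 1

/-- One branch of a computation, that is, one sequence of measurement outcomes: the classical
memory, the projected and not renormalised quantum state, the number of calls to the oracle, to
`U` and to `U⁻¹`, and the number of elementary steps (these calls included). -/
structure Branch (H : Type*) [NormedAddCommGroup H] (d w c : ℕ) where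
  mem : Fin c → Bool
  vec : QState H d w
  calls : ℕ
  steps : ℕ

namespace Branch

variable {H : Type*} [NormedAddCommGroup H] {d w c : ℕ}

/-- The probability of the branch: the squared norm of its unnormalised state. -/
def weight (s : Branch H d w c) : ℝ := ∑ x, ‖s.vec x‖ ^ 2

/-- Spend `n` elementary steps. -/
def spend (s : Branch H d w c) (n : ℕ) : Branch H d w c := { s with steps := s.steps + n }

/-- Replace the quantum state by the result `v` of a call. -/
def call (s : Branch H d w c) (v : QState H d w) : Branch H d w c :=
  { s with vec := v, calls := s.calls + 1, steps := s.steps + 1 }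

/-- Set the bit `k` to `b`. -/
def setBit (s : Branch H d w c) (k : Fin c) (b : Bool) : Branch H d w c :=
  { s with mem := Function.update s.mem k b }

end Branch

section Semantics

variable {H : Type*} [NormedAddCommGroup H] [InnerProductSpace ℂ H] {d w c : ℕ}

open Classical in
/-- The action of a controlled one-qubit gate. -/
def applyGate (lab : Option (Fin d)) (ctrl : List (Fin w × Bool))
    (G : Matrix.unitaryGroup Bool ℂ) (q : Fin w) (v : QState H d w) : QState H d w :=
  fun x => WithLp.toLp 2 fun i =>
    if (∀ j ∈ lab, i = j) ∧ (∀ p ∈ ctrl, x p.1 = p.2) then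
      ∑ b : Bool, (G : Matrix Bool Bool ℂ) (x q) b • v (Function.update x q b) i
    else v x i

/-- The action of `P ⊗ 𝕀 + (1 - P) ⊗ σₓ`, `P = |φ⟩⟨φ|`, on register `A` and qubit `q`. -/
def applyOracle (φ : H) (q : Fin w) (v : QState H d w) : QState H d w :=
  fun x => WithLp.toLp 2 fun i =>
    proj φ (v x i) +
      (v (Function.update x q (!x q)) i - proj φ (v (Function.update x q (!x q)) i))

/-- The projection to qubit `q` being in the state `|b⟩`. -/
def project (q : Fin w) (b : Bool) (v : QState H d w) : QState H d w :=
  fun x => if x q = b then v x else 0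

/-- At most `n` tests of the condition of a loop, each counted as one step; the list of those
branches that have left the loop by then. -/
def loop (k : Fin c) (body : Branch H d w c → List (Branch H d w c)) :
    ℕ → Branch H d w c → List (Branch H d w c)
  | 0, _ => []
  | n + 1, s =>
      if s.mem k then (body (s.spend 1)).flatMap (loop k body n) else [s.spend 1]

/-- The list of all branches that reach the end of the program from `s`, when no execution of a
loop may test its condition more than `n` times. -/
def exec (φ : H) (U : Joint H d ≃ₗᵢ[ℂ] Joint H d) (n : ℕ) :
    Prog d w c → Branch H d w c → List (Branch H d w c)
  | .skip, s => [s.spend 1]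
  | .gate lab ctrl G q _, s =>
      [{ s.spend (gateCost lab ctrl) with vec := applyGate lab ctrl G q s.vec }]
  | .oracle q, s => [s.call (applyOracle φ q s.vec)]
  | .povm, s => [s.call fun x => U (s.vec x)]
  | .povmInv, s => [s.call fun x => U.symm (s.vec x)]
  | .meas q k, s =>
      [{ (s.spend 1).setBit k false with vec := project q false s.vec },
       { (s.spend 1).setBit k true with vec := project q true s.vec }]
  | .assign k f i j, s => [(s.spend 1).setBit k (f (s.mem i) (s.mem j))]
  | .seq p₁ p₂, s => (exec φ U n p₁ s).flatMap (exec φ U n p₂)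
  | .ite k p₁ p₂, s =>
      if s.mem k then exec φ U n p₁ (s.spend 1) else exec φ U n p₂ (s.spend 1)
  | .while k body, s => loop k (exec φ U n body) n s

end Semantics

/-- An algorithm that estimates `d` numbers: its work space, its program, and the classical bits in
which it leaves the `digits` binary digits of each estimate. -/
structure Algorithm (d : ℕ) where
  qubits : ℕ
  bits : ℕ
  digits : ℕ
  prog : Prog d qubits bits
  out : Fin d → Fin digits → Fin bits

namespace Algorithm

variable {d : ℕ}

/-- The size of the algorithm: space, length of the output and length of the program. -/
def size (𝒜 : Algorithm d) : ℕ := 𝒜.qubits + 𝒜.bits + d * 𝒜.digits + 𝒜.prog.size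

variable {H : Type*} [NormedAddCommGroup H] [InnerProductSpace ℂ H]

/-- The initial configuration: `A` holds the state `φ`, register `B` is in its first basis state,
all qubits are `|0⟩`, all bits are `0`. -/
def start [NeZero d] (𝒜 : Algorithm d) (φ : H) : Branch H d 𝒜.qubits 𝒜.bits where
  mem := fun _ => false
  vec := Pi.single (fun _ => false) (withFirst φ)
  calls := 0
  steps := 0

/-- The estimate `q_i^est`, read as a binary fraction off the final memory. -/
def estimate (𝒜 : Algorithm d) (mem : Fin 𝒜.bits → Bool) (i : Fin d) : ℝ :=
  ∑ k : Fin 𝒜.digits, if mem (𝒜.out i k) then ((2 : ℝ)⁻¹) ^ (k.val + 1) else 0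

/-- The expectation of `f` at the end of a run on one copy of `φ`, with oracle access to
`|φ⟩⟨φ|` and to `U`; runs that do not end contribute `0`. -/
def expect [NeZero d] (𝒜 : Algorithm d) (φ : H) (U : Joint H d ≃ₗᵢ[ℂ] Joint H d)
    (f : Branch H d 𝒜.qubits 𝒜.bits → ℝ≥0∞) : ℝ≥0∞ :=
  ⨆ n : ℕ, ((exec φ U n 𝒜.prog (𝒜.start φ)).map
    fun s => ENNReal.ofReal s.weight * f s).sum

/-- The probability that the run ends, and ends in a configuration that satisfies `S`. -/
def prob [NeZero d] (𝒜 : Algorithm d) (φ : H) (U : Joint H d ≃ₗᵢ[ℂ] Joint H d)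
    (S : Set (Branch H d 𝒜.qubits 𝒜.bits)) : ℝ≥0∞ :=
  𝒜.expect φ U (S.indicator 1)

end Algorithm

/-- Register `A` is in the state `φ`, not entangled with anything else: the joint state is
`φ ⊗ a` for a (possibly unnormalised) state `a` of `B` and the qubits. -/
def Undamaged {H : Type*} [NormedAddCommGroup H] [InnerProductSpace ℂ H] {d w : ℕ}
    (φ : H) (v : QState H d w) : Prop :=
  ∃ a : (Fin w → Bool) → Fin d → ℂ, ∀ x i, v x i = a x i • φ

end QTomo

end

open QTomo

/-!
The probability `q` of an outcome `i` is turned into an angle. In the space of the two registers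
and one work qubit, let `u = φ ⊗ |first⟩ ⊗ |0⟩`, and let `F` be the subspace in which `U` would
show outcome `i` and the work qubit is in the state `|0⟩ / 2 + √3 |1⟩ / 2`. The product of the
reflections in `u` and in `F` keeps a plane through `u` and is, up to sign, the rotation of this
plane by the angle `x` with `cos x = 1 - q / 2` (`exec_grover`). The work qubit confines `x` to
`[0, π / 3]`, where `q = 2 (1 - cos x)` is a Lipschitz function of `x`, and each reflection costs
two calls.

Rotate `k` times and measure whether the state is `u`. The answer is a coin flip with bias `p =
sin² (k x)`. If it damages the state, then the state is the vector of the plane orthogonal to `u`,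
and rotating `k` times and measuring again restores `u` with probability `p`. The damage occurs
with the same probability `p`, so that one repetition per flip is expected, whatever `k` and `x`
are (`restore_cost`), and almost surely the state comes back undamaged. For this reason the notion
`Reliable`, which the whole analysis rests on, speaks only of programs that start and end in the
initial quantum state.

Hence `x` can be found by search. An interval `[l, l + Δ]` for `x` has a multiplier `k` with `k Δ
≥ π / 16` such that `[k l, k (l + Δ)]` lies in one quadrant (`exists_multiplier`), and there the
coin decides between the lower and the upper two thirds of the interval: the biases on the outer
thirds differ from that at the midpoint by a constant (`split_works`). With `κ (L + j)` flips at
height `j` above the leaves, where `L = log (d / ε)`, Chernoff's bound gives an error `(ε / d)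
2⁻ʲ` for this step (`flips_low`, `flips_high`), so that all steps together err with probability at
most `ε / d` (`tree_error`). The calls, of the order of `(L + j) / Δ`, are dominated by the last
steps, because the lengths `Δ = Δ₀ (3 / 2) ^ j` are geometric; their sum is `O(L / δ)`
(`tree_reliable`), without a factor `log (1 / δ)`. The search is hard-wired as a decision tree;
its depth is logarithmic in `1 / δ`, so its size is polynomial (`size_tree_le`). Doing this for
each outcome in turn proves the theorem (`assemble_spec`). For `d = 1` or `δ > 1`, a fixed answer
is correct, and `log (d / ε)` is bounded below by a positive constant in all other cases.
-/

namespace QTomo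

/-! ### Weighted sums over the branches of a computation -/

section Calculus

variable {H : Type*} [NormedAddCommGroup H] {d c : ℕ}

/-- The sum of `G` over a list of branches, each branch counted with its probability. -/
noncomputable def wsum {w : ℕ} (l : List (Branch H d w c)) (G : Branch H d w c → ℝ) : ℝ :=
  (l.map fun t => t.weight * G t).sum

theorem Branch.weight_nonneg {w : ℕ} (s : Branch H d w c) : 0 ≤ s.weight :=
  Finset.sum_nonneg fun _ _ => by positivity

@[simp] theorem wsum_nil {w : ℕ} (G : Branch H d w c → ℝ) : wsum [] G = 0 := rfl

@[simp] theorem wsum_cons {w : ℕ} (s : Branch H d w c) (l) (G : Branch H d w c → ℝ) :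
    wsum (s :: l) G = s.weight * G s + wsum l G := by simp [wsum]

theorem wsum_append {w : ℕ} (l₁ l₂ : List (Branch H d w c)) (G : Branch H d w c → ℝ) :
    wsum (l₁ ++ l₂) G = wsum l₁ G + wsum l₂ G := by simp [wsum]

theorem wsum_add {w : ℕ} (l : List (Branch H d w c)) (G₁ G₂ : Branch H d w c → ℝ) :
    wsum l (fun t => G₁ t + G₂ t) = wsum l G₁ + wsum l G₂ := by
  simp [wsum, mul_add]

theorem wsum_const {w : ℕ} (l : List (Branch H d w c)) (a : ℝ) :
    wsum l (fun _ => a) = a * wsum l (fun _ => 1) := by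
  simp only [wsum, ← List.sum_map_mul_left]
  congr 2; funext t; ring

theorem wsum_mono {w : ℕ} {l : List (Branch H d w c)} {G₁ G₂ : Branch H d w c → ℝ}
    (h : ∀ t ∈ l, G₁ t ≤ G₂ t) : wsum l G₁ ≤ wsum l G₂ :=
  List.sum_le_sum fun t ht => mul_le_mul_of_nonneg_left (h t ht) t.weight_nonneg

theorem wsum_nonneg {w : ℕ} {l : List (Branch H d w c)} {G : Branch H d w c → ℝ}
    (h : ∀ t ∈ l, 0 ≤ G t) : 0 ≤ wsum l G :=
  List.sum_nonneg fun x hx => by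
    obtain ⟨t, ht, rfl⟩ := List.mem_map.1 hx
    exact mul_nonneg t.weight_nonneg (h t ht)

theorem wsum_flatMap_le {w : ℕ} {l : List (Branch H d w c)}
    {f : Branch H d w c → List (Branch H d w c)} {G F : Branch H d w c → ℝ}
    (h : ∀ t ∈ l, wsum (f t) G ≤ t.weight * F t) : wsum (l.flatMap f) G ≤ wsum l F := by
  induction l with
  | nil => simp
  | cons a l ih =>
    rw [List.flatMap_cons, wsum_append, wsum_cons]
    exact add_le_add (h a (by simp)) (ih fun t ht => h t (by simp [ht]))

theorem le_wsum_flatMap {w : ℕ} {l : List (Branch H d w c)}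
    {f : Branch H d w c → List (Branch H d w c)} {G F : Branch H d w c → ℝ}
    (h : ∀ t ∈ l, t.weight * F t ≤ wsum (f t) G) : wsum l F ≤ wsum (l.flatMap f) G := by
  induction l with
  | nil => simp
  | cons a l ih =>
    rw [List.flatMap_cons, wsum_append, wsum_cons]
    exact add_le_add (h a (by simp)) (ih fun t ht => h t (by simp [ht]))

variable [InnerProductSpace ℂ H]

/-! ### Programs that keep the state intact -/

/-- The initial quantum state: `A` holds `φ`, `B` is in its first state and the three work qubits
are `|0⟩`. -/
noncomputable def idle [NeZero d] (φ : H) : QState H d 3 :=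
  Pi.single (fun _ => false) (withFirst φ)

/-- The quantum state of the branch is the initial one, up to a scalar. -/
def Clean [NeZero d] (φ : H) (s : Branch H d 3 c) : Prop := ∃ z : ℂ, s.vec = z • idle φ

/-- `α` for each call plus `β` for each elementary step.  The pairs `(1, 0)` and `(0, 1)` are the
two costs of interest; carrying both at once avoids proving every bound twice. -/
def cost {w : ℕ} (α β : ℝ) (s : Branch H d w c) : ℝ := α * s.calls + β * s.steps

/-- From a clean state, the program almost surely ends, uniformly in the starting branch; it ends
in a clean state; it does not touch the bits outside `S`, it does not create probability, and it
costs at most `A` calls and `B` elementary steps in expectation.  The field `frame` expresses both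
of the middle properties: `G` is any quantity that only looks at the bits outside `S`. -/
structure Reliable [NeZero d] (φ : H) (U : Joint H d ≃ₗᵢ[ℂ] Joint H d) (p : Prog d 3 c)
    (S : Set (Fin c)) (A B : ℕ) : Prop where
  clean : ∀ n s, Clean φ s → ∀ t ∈ exec φ U n p s, Clean φ t
  halts : ∀ η : ℝ, 0 ≤ η → η < 1 → ∃ N, ∀ n ≥ N, ∀ s, Clean φ s →
    η * s.weight ≤ wsum (exec φ U n p s) fun _ => 1
  frame : ∀ G : (Fin c → Bool) → ℝ, (∀ μ, 0 ≤ G μ) →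
    (∀ μ ν, (∀ k ∉ S, μ k = ν k) → G μ = G ν) → ∀ n s, Clean φ s →
      wsum (exec φ U n p s) (fun t => G t.mem) ≤ s.weight * G s.mem
  cost_le : ∀ α β : ℝ, 0 ≤ α → 0 ≤ β → ∀ n s, Clean φ s →
    wsum (exec φ U n p s) (cost α β) ≤ s.weight * (cost α β s + (α * A + β * B))

variable [NeZero d] {φ : H} {U : Joint H d ≃ₗᵢ[ℂ] Joint H d}

theorem Reliable.mass {p : Prog d 3 c} {S : Set (Fin c)} {A B : ℕ} (h : Reliable φ U p S A B)
    (n : ℕ) {s : Branch H d 3 c} (hs : Clean φ s) :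
    wsum (exec φ U n p s) (fun _ => 1) ≤ s.weight := by
  simpa using h.frame (fun _ => 1) (fun _ => zero_le_one) (fun _ _ _ => rfl) n s hs

theorem Reliable.mono {p : Prog d 3 c} {S S' : Set (Fin c)} {A B A' B' : ℕ}
    (h : Reliable φ U p S A B) (hS : S ⊆ S') (hA : A ≤ A') (hB : B ≤ B') :
    Reliable φ U p S' A' B' where
  clean := h.clean
  halts := h.halts
  frame G hG hG' := h.frame G hG fun μ ν hk => hG' μ ν fun k hk' => hk k fun hk'' => hk' (hS hk'')
  cost_le α β hα hβ n s hs := (h.cost_le α β hα hβ n s hs).trans <| by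
    have := s.weight_nonneg
    gcongr

theorem Reliable.seq {p₁ p₂ : Prog d 3 c} {S : Set (Fin c)} {A₁ A₂ B₁ B₂ : ℕ}
    (h₁ : Reliable φ U p₁ S A₁ B₁) (h₂ : Reliable φ U p₂ S A₂ B₂) :
    Reliable φ U (.seq p₁ p₂) S (A₁ + A₂) (B₁ + B₂) where
  clean n s hs t ht := by
    obtain ⟨r, hr, hrt⟩ := List.mem_flatMap.1 ht
    exact h₂.clean n r (h₁.clean n s hs r hr) t hrt
  halts η h0 h1 := by
    -- run both parts until each has lost a fraction at most `(1 - η) / 2`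
    obtain ⟨N₁, hN₁⟩ := h₁.halts ((1 + η) / 2) (by linarith) (by linarith)
    obtain ⟨N₂, hN₂⟩ := h₂.halts ((1 + η) / 2) (by linarith) (by linarith)
    refine ⟨max N₁ N₂, fun n hn s hs => ?_⟩
    have e₁ := hN₁ n (le_of_max_le_left hn) s hs
    have e₂ : wsum (exec φ U n p₁ s) (fun _ => (1 + η) / 2) ≤
        wsum (exec φ U n (.seq p₁ p₂) s) fun _ => 1 :=
      le_wsum_flatMap fun t ht => by
        rw [mul_comm]
        exact hN₂ n (le_of_max_le_right hn) t (h₁.clean n s hs t ht)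
    rw [wsum_const] at e₂
    have hw := s.weight_nonneg
    have h3 : (1 + η) / 2 * ((1 + η) / 2 * s.weight) ≤
        (1 + η) / 2 * wsum (exec φ U n p₁ s) fun _ => 1 :=
      mul_le_mul_of_nonneg_left e₁ (by linarith)
    nlinarith [mul_nonneg (sq_nonneg (1 - η)) hw]
  frame G hG hS n s hs :=
    (wsum_flatMap_le fun t ht => h₂.frame G hG hS n t (h₁.clean n s hs t ht)).trans
      (h₁.frame G hG hS n s hs)
  cost_le α β hα hβ n s hs := by
    refine (wsum_flatMap_le fun t ht => h₂.cost_le α β hα hβ n t (h₁.clean n s hs t ht)).trans ?_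
    rw [wsum_add, wsum_const]
    have e₁ := h₁.cost_le α β hα hβ n s hs
    have e₂ := mul_le_mul_of_nonneg_left (h₁.mass n hs) (show 0 ≤ α * A₂ + β * B₂ by positivity)
    push_cast
    linarith

theorem clean_spend {s : Branch H d 3 c} (n : ℕ) : Clean φ (s.spend n) ↔ Clean φ s := Iff.rfl

theorem Reliable.ite {p₁ p₂ : Prog d 3 c} {S : Set (Fin c)} {A B : ℕ} (k : Fin c)
    (h₁ : Reliable φ U p₁ S A B) (h₂ : Reliable φ U p₂ S A B) :
    Reliable φ U (.ite k p₁ p₂) S A (B + 1) where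
  clean n s hs t ht := by
    simp only [exec] at ht
    split at ht
    · exact h₁.clean n _ ((clean_spend 1).2 hs) t ht
    · exact h₂.clean n _ ((clean_spend 1).2 hs) t ht
  halts η h0 h1 := by
    obtain ⟨N₁, hN₁⟩ := h₁.halts η h0 h1
    obtain ⟨N₂, hN₂⟩ := h₂.halts η h0 h1
    refine ⟨max N₁ N₂, fun n hn s hs => ?_⟩
    simp only [exec]
    split
    · exact hN₁ n (le_of_max_le_left hn) (s.spend 1) hs
    · exact hN₂ n (le_of_max_le_right hn) (s.spend 1) hs
  frame G hG hS n s hs := by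
    simp only [exec]
    split
    · exact h₁.frame G hG hS n (s.spend 1) hs
    · exact h₂.frame G hG hS n (s.spend 1) hs
  cost_le α β hα hβ n s hs := by
    have key : s.weight * (cost α β (s.spend 1) + (α * A + β * B)) =
        s.weight * (cost α β s + (α * A + β * ↑(B + 1))) := by
      simp only [cost, Branch.spend]; push_cast; ring
    simp only [exec]
    split
    · exact (h₁.cost_le α β hα hβ n (s.spend 1) hs).trans key.le
    · exact (h₂.cost_le α β hα hβ n (s.spend 1) hs).trans key.le

/-- Programs that change nothing but the classical memory. -/
theorem Reliable.of_classical {p : Prog d 3 c} {S : Set (Fin c)} {B : ℕ}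
    (h : ∀ n s, ∃ μ : Fin c → Bool, (∀ k ∉ S, μ k = s.mem k) ∧
      exec φ U n p s = [⟨μ, s.vec, s.calls, s.steps + B⟩]) :
    Reliable φ U p S 0 B where
  clean n s hs t ht := by
    obtain ⟨μ, -, e⟩ := h n s
    rw [e, List.mem_singleton] at ht
    subst ht
    exact hs
  halts η h0 h1 := ⟨0, fun n _ s hs => by
    obtain ⟨μ, -, e⟩ := h n s
    have hw := s.weight_nonneg
    have : Branch.weight ⟨μ, s.vec, s.calls, s.steps + B⟩ = s.weight := rfl
    rw [e, wsum_cons, wsum_nil, this]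
    nlinarith⟩
  frame G hG hS n s hs := by
    obtain ⟨μ, hμ, e⟩ := h n s
    have : Branch.weight ⟨μ, s.vec, s.calls, s.steps + B⟩ = s.weight := rfl
    rw [e, wsum_cons, wsum_nil, this, hS μ s.mem hμ, add_zero]
  cost_le α β hα hβ n s hs := by
    obtain ⟨μ, hμ, e⟩ := h n s
    have : Branch.weight ⟨μ, s.vec, s.calls, s.steps + B⟩ = s.weight := rfl
    rw [e, wsum_cons, wsum_nil, this, add_zero]
    apply le_of_eq
    simp only [cost]; push_cast; ring

theorem Reliable.skip (S : Set (Fin c)) : Reliable φ U (.skip : Prog d 3 c) S 0 1 :=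
  .of_classical fun _ s => ⟨s.mem, fun _ _ => rfl, rfl⟩

end Calculus

/-- Run the programs of a list one after the other. -/
def seqs {d w c : ℕ} : List (Prog d w c) → Prog d w c
  | [] => .skip
  | p :: l => .seq p (seqs l)

theorem size_seqs_le {d w c : ℕ} {l : List (Prog d w c)} {b : ℕ} (h : ∀ p ∈ l, p.size ≤ b) :
    (seqs l).size ≤ l.length * (b + 1) + 1 := by
  induction l with
  | nil => simp [seqs, Prog.size]
  | cons p l ih =>
    have h₁ := h p (by simp)
    have h₂ := ih fun q hq => h q (by simp [hq])
    simp only [seqs, Prog.size, List.length_cons, add_mul]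
    omega

theorem Reliable.seqs {H : Type*} [NormedAddCommGroup H] [InnerProductSpace ℂ H] {d c : ℕ}
    [NeZero d] {φ : H} {U : Joint H d ≃ₗᵢ[ℂ] Joint H d} {l : List (Prog d 3 c)}
    {S : Set (Fin c)} {A B : ℕ} (h : ∀ p ∈ l, Reliable φ U p S A B) :
    Reliable φ U (seqs l) S (l.length * A) (l.length * B + 1) := by
  induction l with
  | nil => exact (Reliable.skip S).mono subset_rfl (by simp) (by simp)
  | cons p l ih =>
    refine ((h p (by simp)).seq (ih fun q hq => h q (by simp [hq]))).mono subset_rfl ?_ ?_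
    · simp only [List.length_cons, add_mul]; omega
    · simp only [List.length_cons, add_mul]; omega

/-! ### Gates and oracle calls on the work qubits -/

section Gates

variable {H : Type*} [NormedAddCommGroup H] [InnerProductSpace ℂ H] {d : ℕ}

theorem proj_zero (φ : H) : proj φ (0 : H) = 0 := by simp [proj]

theorem proj_add (φ χ ψ : H) : proj φ (χ + ψ) = proj φ χ + proj φ ψ := by
  simp [proj, add_smul]

theorem proj_sub (φ χ ψ : H) : proj φ (χ - ψ) = proj φ χ - proj φ ψ := by
  simp [proj, sub_smul]

theorem proj_smul (φ : H) (a : ℂ) (χ : H) : proj φ (a • χ) = a • proj φ χ := by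
  simp [proj, mul_smul]

theorem proj_proj {φ : H} (hφ : ‖φ‖ = 1) (χ : H) : proj φ (proj φ χ) = proj φ χ := by
  simp [proj, inner_self_eq_norm_sq_to_K, hφ]

/-- The phase `-1`. -/
noncomputable def minusGate : Matrix.unitaryGroup Bool ℂ :=
  ⟨Matrix.of fun a b => if a = b then -1 else 0, by
    rw [Matrix.mem_unitaryGroup_iff]
    ext a b
    cases a <;> cases b <;> simp [Matrix.mul_apply, Matrix.star_apply]⟩

/-- The gate `σₓ`. -/
noncomputable def notGate : Matrix.unitaryGroup Bool ℂ :=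
  ⟨Matrix.of fun a b => if a = b then 0 else 1, by
    rw [Matrix.mem_unitaryGroup_iff]
    ext a b
    cases a <;> cases b <;> simp [Matrix.mul_apply, Matrix.star_apply]⟩

theorem sqrt_three_mul_self : ((√3 : ℝ) : ℂ) * ((√3 : ℝ) : ℂ) = 3 := by
  rw [← Complex.ofReal_mul, Real.mul_self_sqrt (by norm_num)]; norm_num

/-- The reflection that takes `|0⟩` to `|0⟩ / 2 + √3 |1⟩ / 2`. -/
noncomputable def tiltGate : Matrix.unitaryGroup Bool ℂ :=
  ⟨Matrix.of fun a b => if a = b then (if a then -1 / 2 else 1 / 2) else ((√3 : ℝ) : ℂ) / 2, by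
    have h := sqrt_three_mul_self
    rw [Matrix.mem_unitaryGroup_iff]
    ext a b
    cases a <;> cases b <;> simp [Matrix.mul_apply, Matrix.star_apply, map_ofNat] <;> grind⟩

/-- The state of `A`, `B` and three qubits whose first qubit is `|0⟩` and whose components along
the other two are given by `h`. -/
def pairState (h : Bool → Bool → Joint H d) : QState H d 3 :=
  fun x => if x 0 = false then h (x 1) (x 2) else 0

/-- The component of a joint state in which `B` is in the state `|i⟩`. -/
def slot (i : Fin d) (ψ : Joint H d) : Joint H d := WithLp.toLp 2 (Pi.single i (ψ i))

/-- The orthogonal projection `P ⊗ |first⟩⟨first|` of `A ⊗ B`. -/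
noncomputable def projFirst [NeZero d] (φ : H) (ψ : Joint H d) : Joint H d :=
  withFirst (proj φ (ψ 0))

theorem applyGate_tilt (h : Bool → Bool → Joint H d) :
    applyGate none [] tiltGate 2 (pairState h) = pairState fun b e =>
      ∑ e', (tiltGate : Matrix Bool Bool ℂ) e e' • h b e' := by
  funext x; ext j
  simp [applyGate, pairState]
  split <;> simp

theorem applyGate_minus_some (i : Fin d) (h : Bool → Bool → Joint H d) :
    applyGate (some i) [(2, false)] minusGate 1 (pairState h) = pairState fun b e =>
      if e = false then h b e - (2 : ℂ) • slot i (h b e) else h b e := by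
  funext x; ext j
  by_cases hj : j = i
  · subst hj
    cases h0 : x 0 <;> cases h1 : x 1 <;> cases h2 : x 2 <;>
      simp [applyGate, pairState, slot, minusGate, h0, h1, h2, two_smul]
  · cases h0 : x 0 <;> cases h1 : x 1 <;> cases h2 : x 2 <;>
      simp [applyGate, pairState, slot, hj, h0, h2, h1]

theorem applyGate_not_one (h : Bool → Bool → Joint H d) :
    applyGate none [] notGate 1 (pairState h) = pairState fun b e => h (!b) e := by
  funext x; ext j
  cases h0 : x 0 <;> cases h1 : x 1 <;> cases h2 : x 2 <;>
      simp [applyGate, pairState, notGate, h0, h1, h2]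

/-- A gate on the middle qubit, controlled by the first qubit, between two calls of the oracle on
the first qubit, is the gate controlled by `φ ⊗ |first⟩`, and the first qubit is reset. -/
theorem applyOracle_gate_oracle [NeZero d] {φ : H} (hφ : ‖φ‖ = 1) (G : Matrix.unitaryGroup Bool ℂ)
    (h : Bool → Bool → Joint H d) :
    applyOracle φ 0 (applyGate (some 0) [(0, false), (2, false)] G 1
      (applyOracle φ 0 (pairState h))) = pairState fun b e =>
        if e = false then
          h b e + projFirst φ ((∑ b', (G : Matrix Bool Bool ℂ) b b' • h b' e) - h b e)
        else h b e := by
  funext x; ext j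
  by_cases hj : j = 0
  · subst hj
    cases h0 : x 0 <;> cases h1 : x 1 <;> cases h2 : x 2 <;>
      simp [applyGate, pairState, applyOracle, projFirst, withFirst, proj_sub, proj_add,
        proj_smul, proj_zero, proj_proj hφ, h0, h1, h2] <;>
      abel
  · cases h0 : x 0 <;> cases h1 : x 1 <;> cases h2 : x 2 <;>
      simp [applyGate, pairState, applyOracle, projFirst, withFirst, proj_sub, proj_add,
        proj_smul, proj_zero, proj_proj hφ, h0, h1, h2, hj]

/-! ### The rotation in the plane of a measurement outcome -/

section Plane

variable [NeZero d] (φ : H) (U : Joint H d ≃ₗᵢ[ℂ] Joint H d) (i : Fin d)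

/-- The probability of outcome `i`, when `U` is applied to `φ ⊗ |first⟩` and `B` is measured. -/
noncomputable def hitProb : ℝ := ‖U (withFirst φ) i‖ ^ 2

/-- The projection of `φ ⊗ |first⟩` to the subspace of outcome `i`. -/
noncomputable def hit : Joint H d := U.symm (slot i (U (withFirst φ)))

/-- The angle `x` with `cos x = 1 - q / 2`, where `q` is the probability of outcome `i`. -/
noncomputable def angle : ℝ := Real.arccos (1 - hitProb φ U i / 2)

/-- The vector `φ ⊗ |first⟩ ⊗ |0⟩`, by its components along the third qubit. -/
noncomputable def axis (e : Bool) : Joint H d := if e = false then withFirst φ else 0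

/-- The unit vector orthogonal to `axis` in the plane that it spans with its projection to the
subspace of outcome `i` and third qubit `tiltGate |0⟩`, by its components along the third qubit.
It is `0` if outcome `i` is impossible. -/
noncomputable def coaxis (e : Bool) : Joint H d :=
  ((2 / Real.sin (angle φ U i) : ℝ) : ℂ) •
    (((tiltGate : Matrix Bool Bool ℂ) e false * (1 / 2)) • hit φ U i -
      ((hitProb φ U i / 4 : ℝ) : ℂ) • axis (d := d) φ e)

/-- The vector with coordinates `z₁`, `z₂` in the plane of `axis` and `coaxis`; the first two
qubits are `|0⟩`. -/
noncomputable def plane (z₁ z₂ : ℂ) : QState H d 3 :=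
  pairState fun b e => if b = false then z₁ • axis φ e + z₂ • coaxis φ U i e else 0

omit [InnerProductSpace ℂ H] in
theorem norm_withFirst : ‖(withFirst φ : Joint H d)‖ = ‖φ‖ := by
  simp [withFirst]

theorem idle_eq_plane (z : ℂ) : z • idle φ = plane φ U i z 0 := by
  funext x
  cases h0 : x 0 <;> cases h1 : x 1 <;> cases h2 : x 2 <;>
    simp [idle, plane, pairState, axis, Pi.single_apply, funext_iff, Fin.forall_fin_succ, h0, h1,
      h2]

variable {φ}

theorem hitProb_le_one (hφ : ‖φ‖ = 1) : hitProb φ U i ≤ 1 := by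
  have h : ‖U (withFirst φ) i‖ ≤ 1 := by
    simpa [norm_withFirst, hφ] using PiLp.norm_apply_le (U (withFirst φ)) i
  exact pow_le_one₀ (norm_nonneg _) h

theorem hitProb_nonneg : 0 ≤ hitProb φ U i := by unfold hitProb; positivity

theorem cos_angle (hφ : ‖φ‖ = 1) : Real.cos (angle φ U i) = 1 - hitProb φ U i / 2 := by
  have h0 := hitProb_nonneg (φ := φ) U i
  have h1 := hitProb_le_one U i hφ
  exact Real.cos_arccos (by linarith) (by linarith)

theorem angle_nonneg : 0 ≤ angle φ U i := Real.arccos_nonneg _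

theorem angle_le (hφ : ‖φ‖ = 1) : angle φ U i ≤ Real.pi / 3 := by
  have h1 := hitProb_le_one U i hφ
  have h : Real.arccos (1 / 2) = Real.pi / 3 := by
    rw [← Real.cos_pi_div_three, Real.arccos_cos (by positivity) (by linarith [Real.pi_pos])]
  rw [← h]
  exact Real.arccos_le_arccos (by linarith)

theorem projFirst_withFirst (hφ : ‖φ‖ = 1) :
    projFirst φ (withFirst φ : Joint H d) = withFirst φ := by
  simp [projFirst, withFirst, proj, inner_self_eq_norm_sq_to_K, hφ]

theorem projFirst_hit : projFirst φ (hit φ U i) = ((hitProb φ U i : ℝ) : ℂ) • withFirst φ := by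
  have h : inner ℂ φ (hit φ U i 0) = ((hitProb φ U i : ℝ) : ℂ) := by
    have h₁ : inner ℂ (withFirst φ) (hit φ U i) = inner ℂ φ (hit φ U i 0) := by
      rw [PiLp.inner_apply, Finset.sum_eq_single 0] <;> simp +contextual [withFirst]
    rw [← h₁, ← U.inner_map_map, hit, U.apply_symm_apply, PiLp.inner_apply,
      Finset.sum_eq_single i] <;>
      simp +contextual [slot, hitProb, inner_self_eq_norm_sq_to_K]
  ext j
  simp only [projFirst, proj, h, withFirst]
  by_cases hj : j = 0
  · subst hj; simp
  · simp [hj]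

theorem hit_eq_zero (h : hitProb φ U i = 0) : hit φ U i = 0 := by
  have h' : U (withFirst φ) i = 0 := by simpa [hitProb] using h
  simp [hit, slot, h']

end Plane

end Gates

/-! ### The programs that rotate and measure -/

section Programs

variable {d c : ℕ} [NeZero d]

/-- The product of the reflections in `φ ⊗ |first⟩ ⊗ |0⟩` and in the subspace of outcome `i` and
third qubit `tiltGate |0⟩`. -/
noncomputable def grover (i : Fin d) : Prog d 3 c :=
  .seq (.gate none [] tiltGate 2 (by simp)) <| .seq .povm <|
  .seq (.gate (some i) [(2, false)] minusGate 1 (by simp)) <| .seq .povmInv <|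
  .seq (.gate none [] tiltGate 2 (by simp)) <| .seq (.oracle 0) <|
  .seq (.gate (some 0) [(0, false), (2, false)] minusGate 1 (by simp)) (.oracle 0)

/-- The `k`-th power of the rotation. -/
noncomputable def groverPow (i : Fin d) : ℕ → Prog d 3 c
  | 0 => .skip
  | k + 1 => .seq (grover i) (groverPow i k)

/-- Measure whether the state is `φ ⊗ |first⟩ ⊗ |0⟩`; the bit `m` is set if it is not.  The second
qubit is used for the outcome and reset. -/
noncomputable def measureAxis (m : Fin c) : Prog d 3 c :=
  .seq (.gate none [] notGate 1 (by simp)) <| .seq (.oracle 0) <|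
  .seq (.gate (some 0) [(0, false), (2, false)] notGate 1 (by simp)) <| .seq (.oracle 0) <|
  .seq (.meas 1 m) (.ite m (.gate none [] notGate 1 (by simp)) .skip)

/-- Rotate `k` times and measure. -/
noncomputable def round (i : Fin d) (k : ℕ) (m : Fin c) : Prog d 3 c :=
  .seq (groverPow i k) (measureAxis m)

/-- The number of elementary steps of `round`. -/
def roundSteps (d k : ℕ) : ℕ := k * (11 + 2 * Nat.clog 2 d) + 10 + Nat.clog 2 d

theorem size_round_le (i : Fin d) (k : ℕ) (m : Fin c) :
    (round i k m).size ≤ (k + 1) * (30 + 2 * Nat.clog 2 d) := by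
  have h : ∀ k, (groverPow i k : Prog d 3 c).size = k * (19 + 2 * Nat.clog 2 d) + 1 := by
    intro k
    induction k with
    | zero => simp [groverPow, Prog.size]
    | succ k ih =>
      rw [groverPow, Prog.size, ih]
      simp [grover, Prog.size, gateCost]
      ring
  simp [round, measureAxis, Prog.size, gateCost, h]
  ring_nf
  nlinarith

variable {H : Type*} [NormedAddCommGroup H] [InnerProductSpace ℂ H]
  {φ : H} (U : Joint H d ≃ₗᵢ[ℂ] Joint H d) (i : Fin d)

omit [NeZero d] [InnerProductSpace ℂ H] in
theorem slot_slot (ψ : Joint H d) : slot i (slot i ψ) = slot i ψ := by simp [slot]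

omit [NeZero d] [InnerProductSpace ℂ H] in
theorem slot_add (ψ χ : Joint H d) : slot i (ψ + χ) = slot i ψ + slot i χ := by
  ext j; by_cases hj : j = i
  · subst hj; simp [slot]
  · simp [slot, hj]

omit [NeZero d] in
theorem slot_smul (a : ℂ) (ψ : Joint H d) : slot i (a • ψ) = a • slot i ψ := by
  ext j; by_cases hj : j = i
  · subst hj; simp [slot]
  · simp [slot, hj]

theorem projFirst_add (ψ χ : Joint H d) :
    projFirst φ (ψ + χ) = projFirst φ ψ + projFirst φ χ := by
  ext j; by_cases hj : j = 0
  · subst hj; simp [projFirst, withFirst, proj_add]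
  · simp [projFirst, withFirst, hj]

theorem projFirst_smul (a : ℂ) (ψ : Joint H d) :
    projFirst φ (a • ψ) = a • projFirst φ ψ := by
  ext j; by_cases hj : j = 0
  · subst hj; simp [projFirst, withFirst, proj_smul]
  · simp [projFirst, withFirst, hj]

theorem projFirst_sub (ψ χ : Joint H d) :
    projFirst φ (ψ - χ) = projFirst φ ψ - projFirst φ χ := by
  rw [sub_eq_add_neg, ← neg_one_smul ℂ, projFirst_add, projFirst_smul, neg_one_smul,
    sub_eq_add_neg]

theorem projFirst_coaxis (hφ : ‖φ‖ = 1) : projFirst φ (coaxis φ U i false) = 0 := by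
  have ht : (tiltGate : Matrix Bool Bool ℂ) false false = 1 / 2 := by simp [tiltGate]
  rw [coaxis, projFirst_smul, projFirst_sub, projFirst_smul, projFirst_smul, projFirst_hit, axis,
    if_pos rfl, projFirst_withFirst hφ, ht, smul_smul, ← sub_smul]
  push_cast
  rw [show (1 / 2 * (1 / 2) * (hitProb φ U i : ℂ) - hitProb φ U i / 4) = 0 by ring]
  simp

omit [NeZero d] in
theorem map_pairState (V : Joint H d ≃ₗᵢ[ℂ] Joint H d) (h : Bool → Bool → Joint H d) :
    (fun x => V (pairState h x)) = pairState fun b e => V (h b e) := by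
  funext x
  unfold pairState
  split <;> simp

/-- The effect of the two reflections on a state whose first two qubits are `|0⟩`. -/
theorem exec_grover_pairState (hφ : ‖φ‖ = 1) (n : ℕ) (s : Branch H d 3 c) (f : Bool → Joint H d)
    (hs : s.vec = pairState fun b e => if b = false then f e else 0) :
    let g := fun e => f e - (2 * (tiltGate : Matrix Bool Bool ℂ) e false) •
      U.symm (slot i (U (∑ e', (tiltGate : Matrix Bool Bool ℂ) false e' • f e')))
    exec φ U n (grover i) s = [⟨s.mem,
      pairState fun b e => if b = false then
        if e = false then g e - (2 : ℂ) • projFirst φ (g e) else g e else 0,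
      s.calls + 4, s.steps + (11 + 2 * Nat.clog 2 d)⟩] := by
  have h3 := sqrt_three_mul_self
  intro g
  set F : Bool → Joint H d := fun e => ∑ e', (tiltGate : Matrix Bool Bool ℂ) e e' • f e' with hF
  set η : Joint H d := U.symm (slot i (U (F false))) with hη
  have h₁ : ∀ e, U.symm (if e = false then U (F e) - (2 : ℂ) • slot i (U (F e)) else U (F e)) =
      F e - (if e = false then 2 else 0 : ℂ) • η := by
    intro e
    cases e
    · simp [hη]
    · simp
  have key : ∀ e, ∑ e', (tiltGate : Matrix Bool Bool ℂ) e e' • U.symm (if e' = false then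
        U (F e') - (2 : ℂ) • slot i (U (F e')) else U (F e')) = g e := by
    intro e
    have hg : g e = f e - (2 * (tiltGate : Matrix Bool Bool ℂ) e false) • η := rfl
    simp only [h₁, hg]
    clear_value η
    cases e <;> simp [hF, tiltGate] <;> match_scalars <;> grind
  have key' : ∀ h : Bool → Bool → Joint H d, (h = fun b e => if b = false then g e else 0) →
      applyOracle φ 0 (applyGate (some 0) [(0, false), (2, false)] minusGate 1
        (applyOracle φ 0 (pairState h))) = pairState fun b e => if b = false then
          if e = false then g e - (2 : ℂ) • projFirst φ (g e) else g e else 0 := by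
    rintro _ rfl
    rw [applyOracle_gate_oracle hφ]
    congr 1
    funext b e
    clear_value g
    cases b <;> cases e <;> simp [minusGate, projFirst, withFirst, proj_zero]
    rw [show (-g false 0 - g false 0 : H) = (-2 : ℂ) • g false 0 by module, proj_smul]
    ext j
    by_cases hj : j = 0
    · subst hj; simp; module
    · simp [hj]
  simp only [exec, grover, List.flatMap_cons, List.flatMap_nil, List.append_nil, Branch.call,
    Branch.spend, gateCost]
  simp only [hs, applyGate_tilt, map_pairState, applyGate_minus_some]
  simp only [List.cons.injEq, and_true, Branch.mk.injEq, true_and]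
  refine ⟨key' _ ?_, by simp; ring⟩
  funext b e
  cases b
  · simpa [hF] using key e
  · simp [slot]

/-- On the plane, the product of the two reflections is the rotation by the angle of the outcome, up
to sign.  With `α = φ ⊗ |first⟩`, `ξ = hit` and the projection `Π` to the slot of the outcome, all
follows from `U† Π U α = ξ = U† Π U ξ`. -/
theorem exec_grover (hφ : ‖φ‖ = 1) (n : ℕ) (s : Branch H d 3 c) (z₁ z₂ : ℂ)
    (hs : s.vec = plane φ U i z₁ z₂) :
    exec φ U n (grover i) s = [⟨s.mem, plane φ U i
      (-(Real.cos (angle φ U i) * z₁ - Real.sin (angle φ U i) * z₂))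
      (-(Real.sin (angle φ U i) * z₁ + Real.cos (angle φ U i) * z₂)),
      s.calls + 4, s.steps + (11 + 2 * Nat.clog 2 d)⟩] := by
  rw [exec_grover_pairState U i hφ n s _ hs]
  have hα := projFirst_withFirst (d := d) hφ
  have hξ := projFirst_hit (φ := φ) U i
  have hξ0 := hit_eq_zero (φ := φ) U i
  have hc := cos_angle U i hφ
  have hS := Real.sin_sq_add_cos_sq (angle φ U i)
  have hUα : U.symm (slot i (U (withFirst φ))) = hit φ U i := rfl
  have hUξ : U.symm (slot i (U (hit φ U i))) = hit φ U i := by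
    rw [hit, U.apply_symm_apply, slot_slot]
  simp only [plane]
  congr 2
  congr 1
  funext b e
  cases b
  swap
  · simp
  set r : ℂ := ((2 / Real.sin (angle φ U i) : ℝ) : ℂ) with hr
  have h3 := sqrt_three_mul_self
  have hc' : (Real.cos (angle φ U i) : ℂ) = 1 - hitProb φ U i / 2 := by rw [hc]; push_cast; rfl
  have hS' : (Real.sin (angle φ U i) : ℂ) ^ 2 + (Real.cos (angle φ U i) : ℂ) ^ 2 = 1 := by
    exact_mod_cast hS
  have hsum : ∑ e', (tiltGate : Matrix Bool Bool ℂ) false e' •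
      (z₁ • axis φ e' + z₂ • coaxis φ U i e') =
      (z₁ / 2 - z₂ * r * hitProb φ U i / 8) • withFirst φ + (z₂ * r / 2) • hit φ U i := by
    simp only [axis, coaxis, ← hr]
    simp [tiltGate]
    match_scalars <;> grind
  have hproj : U.symm (slot i (U (∑ e', (tiltGate : Matrix Bool Bool ℂ) false e' •
      (z₁ • axis φ e' + z₂ • coaxis φ U i e')))) =
      (z₁ / 2 - z₂ * r * hitProb φ U i / 8 + z₂ * r / 2) • hit φ U i := by
    rw [hsum, map_add, map_smul, map_smul, slot_add, slot_smul, slot_smul, map_add, map_smul,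
      map_smul, hUα, hUξ, ← add_smul]
  rw [hproj]
  have hco := projFirst_coaxis U i hφ
  have haxis : axis (d := d) φ false = withFirst φ := rfl
  -- an impossible outcome: the second reflection fixes `axis`, and `coaxis` is `0`
  by_cases h0 : Real.sin (angle φ U i) = 0
  · have hq : hitProb φ U i = 0 := by
      have := hitProb_nonneg (φ := φ) U i
      have := hitProb_le_one U i hφ
      rw [hc, h0] at hS
      nlinarith
    have hr0 : r = 0 := by simp [hr, h0]
    rw [hq] at hc'
    simp only [hξ0 hq, smul_zero, sub_zero, coaxis, hr, h0, hc']
    cases e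
    · simp [axis, projFirst_smul, hα]; module
    · simp [axis]
  have h0' : (Real.sin (angle φ U i) : ℂ) ≠ 0 := by exact_mod_cast h0
  have hr' : r * Real.sin (angle φ U i) = 2 := by
    rw [hr, ← Complex.ofReal_mul, div_mul_cancel₀ _ h0]; norm_num
  have hv : ∀ e, coaxis φ U i e = r • (((tiltGate : Matrix Bool Bool ℂ) e false * (1 / 2)) •
      hit φ U i - ((hitProb φ U i / 4 : ℝ) : ℂ) • axis (d := d) φ e) := fun _ => rfl
  push_cast at hv
  clear_value r
  generalize (Real.sin (angle φ U i) : ℂ) = S at *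
  generalize (Real.cos (angle φ U i) : ℂ) = C at *
  generalize (hitProb φ U i : ℂ) = q at *
  cases e
  · simp only [projFirst_sub, projFirst_add, projFirst_smul, hco, haxis, hα, hξ]
    simp only [hv, axis]
    simp [tiltGate]
    match_scalars <;> grind
  · simp only [hv, axis]
    simp [tiltGate]
    match_scalars
    grind

theorem exec_groverPow (hφ : ‖φ‖ = 1) (n k : ℕ) (s : Branch H d 3 c) (z₁ z₂ : ℂ)
    (hs : s.vec = plane φ U i z₁ z₂) :
    exec φ U n (groverPow i k) s = [⟨s.mem, plane φ U i
      ((-1) ^ k * (Real.cos (k * angle φ U i) * z₁ - Real.sin (k * angle φ U i) * z₂))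
      ((-1) ^ k * (Real.sin (k * angle φ U i) * z₁ + Real.cos (k * angle φ U i) * z₂)),
      s.calls + 4 * k, s.steps + (k * (11 + 2 * Nat.clog 2 d) + 1)⟩] := by
  induction k generalizing s z₁ z₂ with
  | zero =>
    simp [groverPow, exec, Branch.spend]
    rw [← hs]
  | succ k ih =>
    simp only [groverPow, exec]
    rw [exec_grover U i hφ n s z₁ z₂ hs, List.flatMap_cons, List.flatMap_nil, List.append_nil,
      ih _ _ _ rfl]
    have e : ((k + 1 : ℕ) : ℝ) * angle φ U i = k * angle φ U i + angle φ U i := by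
      push_cast; ring
    simp only [e, Real.cos_add, Real.sin_add, List.cons.injEq, Branch.mk.injEq, true_and, and_true]
    refine ⟨?_, by ring, by ring⟩
    congr 1 <;> (push_cast; ring)

/-- The measurement separates the two coordinates, and the first two qubits end as `|0⟩`. -/
theorem exec_measureAxis (hφ : ‖φ‖ = 1) (n : ℕ) (m : Fin c) (s : Branch H d 3 c) (z₁ z₂ : ℂ)
    (hs : s.vec = plane φ U i z₁ z₂) :
    exec φ U n (measureAxis m) s =
      [⟨Function.update s.mem m false, plane φ U i z₁ 0, s.calls + 2, s.steps + (9 + Nat.clog 2 d)⟩,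
        ⟨Function.update s.mem m true, plane φ U i 0 z₂, s.calls + 2,
          s.steps + (9 + Nat.clog 2 d)⟩] := by
  have h : applyOracle φ 0 (applyGate (some 0) [(0, false), (2, false)] notGate 1
        (applyOracle φ 0 (applyGate none [] notGate 1 (plane φ U i z₁ z₂)))) =
      pairState fun b e => if b = false then z₁ • axis φ e else z₂ • coaxis φ U i e := by
    rw [plane, applyGate_not_one, applyOracle_gate_oracle hφ]
    congr 1
    funext b e
    cases b <;> cases e <;> simp [notGate, projFirst_add, projFirst_smul,
      projFirst_coaxis U i hφ, axis, projFirst_withFirst hφ]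
    rw [← neg_one_smul ℂ, ← neg_one_smul ℂ (z₁ • _), projFirst_smul, projFirst_smul,
      projFirst_smul, projFirst_smul, projFirst_coaxis U i hφ, projFirst_withFirst hφ]
    module
  have h₀ : project 1 false (pairState fun b e => if b = false then z₁ • axis φ e
      else z₂ • coaxis φ U i e) = plane φ U i z₁ 0 := by
    funext x
    cases h0 : x 0 <;> cases h1 : x 1 <;> cases h2 : x 2 <;>
      simp [project, plane, pairState, h0, h1, h2]
  have h₁ : applyGate none [] notGate 1 (project 1 true (pairState fun b e =>
      if b = false then z₁ • axis φ e else z₂ • coaxis φ U i e)) = plane φ U i 0 z₂ := by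
    have e : project 1 true (pairState fun b e =>
        if b = false then z₁ • axis φ e else z₂ • coaxis φ U i e) =
        pairState fun b e => if b = false then 0 else z₂ • coaxis φ U i e := by
      funext x
      cases h0 : x 0 <;> cases h1 : x 1 <;> cases h2 : x 2 <;>
        simp [project, pairState, h0, h1, h2]
    rw [e, applyGate_not_one, plane]
    congr 1
    funext b e
    cases b <;> simp
  simp only [exec, measureAxis, List.flatMap_cons, List.flatMap_nil, List.append_nil, Branch.call,
    Branch.spend, Branch.setBit, gateCost, hs, h, h₀, h₁]
  simp
  ring

theorem exec_round (hφ : ‖φ‖ = 1) (n k : ℕ) (m : Fin c) (s : Branch H d 3 c) (z₁ z₂ : ℂ)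
    (hs : s.vec = plane φ U i z₁ z₂) :
    exec φ U n (round i k m) s =
      [⟨Function.update s.mem m false, plane φ U i
        ((-1) ^ k * (Real.cos (k * angle φ U i) * z₁ - Real.sin (k * angle φ U i) * z₂)) 0,
        s.calls + (4 * k + 2), s.steps + roundSteps d k⟩,
        ⟨Function.update s.mem m true, plane φ U i 0
        ((-1) ^ k * (Real.sin (k * angle φ U i) * z₁ + Real.cos (k * angle φ U i) * z₂)),
        s.calls + (4 * k + 2), s.steps + roundSteps d k⟩] := by
  simp only [round, exec]
  rw [exec_groverPow U i hφ n k s z₁ z₂ hs, List.flatMap_cons, List.flatMap_nil, List.append_nil,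
    exec_measureAxis U i hφ n m _ _ _ rfl]
  simp only [List.cons.injEq, Branch.mk.injEq, true_and, and_true, roundSteps]
  refine ⟨⟨?_, ?_⟩, ?_, ?_⟩ <;> ring

end Programs

/-! ### Coin flips that restore the state -/

/-- Classical bits for a coin flip and a counter: `flag` records the outcome of a measurement, and
`cnt 0, …, cnt M` hold a number `N` in unary, `cnt t` being set if `t ≤ N`. -/
structure Counter (c M : ℕ) where
  flag : Fin c
  cnt : ℕ → Fin c
  inj : ∀ a ≤ M, ∀ b ≤ M, cnt a = cnt b → a = b
  flag_ne : ∀ a ≤ M, cnt a ≠ flag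

namespace Counter

variable {c M : ℕ}

/-- The bits that a counter occupies. -/
def scratch (C : Counter c M) : Set (Fin c) := insert C.flag (C.cnt '' Set.Iic M)

/-- The counter shows the number `N`. -/
def Shows (C : Counter c M) (μ : Fin c → Bool) (N : ℕ) : Prop :=
  ∀ t ≤ M, μ (C.cnt t) = decide (t ≤ N)

theorem flag_mem (C : Counter c M) : C.flag ∈ C.scratch := Set.mem_insert _ _

theorem ne_flag (C : Counter c M) {b : Fin c} (hb : b ∉ C.scratch) : b ≠ C.flag := by
  rintro rfl
  exact hb C.flag_mem

theorem cnt_mem (C : Counter c M) {t : ℕ} (ht : t ≤ M) : C.cnt t ∈ C.scratch :=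
  Set.mem_insert_of_mem _ ⟨t, ht, rfl⟩

theorem Shows.not_shows_succ {C : Counter c M} {μ : Fin c → Bool} {N : ℕ} (hN : N + 1 ≤ M)
    (h : C.Shows μ (N + 1)) : ¬ C.Shows μ N := fun h' => by
  have h₁ := h (N + 1) hN
  rw [h' (N + 1) hN] at h₁
  simp at h₁

theorem Shows.congr {C : Counter c M} {μ ν : Fin c → Bool} {N : ℕ} (h : C.Shows μ N)
    (hν : ∀ b ≠ C.flag, ν b = μ b) : C.Shows ν N := fun t ht => by
  rw [hν _ (C.flag_ne t ht), h t ht]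

end Counter

variable {d c M : ℕ}

/-- Move each of the bits `cnt 0, …, cnt (t - 1)` up by one place. -/
def shift {d w : ℕ} (cnt : ℕ → Fin c) : ℕ → Prog d w c
  | 0 => .skip
  | t + 1 => .seq (.assign (cnt (t + 1)) (fun a _ => a) (cnt t) (cnt t)) (shift cnt t)

theorem size_shift {w : ℕ} (cnt : ℕ → Fin c) (t : ℕ) :
    (shift cnt t : Prog d w c).size = 2 * t + 1 := by
  induction t with
  | zero => rfl
  | succ t ih => simp only [shift, Prog.size, ih]; ring

variable {H : Type*} [NormedAddCommGroup H] [InnerProductSpace ℂ H]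

theorem exec_shift {w : ℕ} (φ : H) (U : Joint H d ≃ₗᵢ[ℂ] Joint H d) (C : Counter c M) (n t : ℕ)
    (ht : t ≤ M) (s : Branch H d w c) :
    ∃ μ : Fin c → Bool, exec φ U n (shift C.cnt t) s = [⟨μ, s.vec, s.calls, s.steps + (t + 1)⟩] ∧
      (∀ b, (∀ j < t, b ≠ C.cnt (j + 1)) → μ b = s.mem b) ∧
      ∀ j < t, μ (C.cnt (j + 1)) = s.mem (C.cnt j) := by
  induction t generalizing s with
  | zero => exact ⟨s.mem, rfl, fun _ _ => rfl, by simp⟩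
  | succ t ih =>
    obtain ⟨μ, h₁, h₂, h₃⟩ := ih (by omega) ((s.spend 1).setBit (C.cnt (t + 1)) (s.mem (C.cnt t)))
    refine ⟨μ, ?_, ?_, ?_⟩
    · simp only [shift, exec, List.flatMap_cons, List.flatMap_nil, List.append_nil]
      rw [h₁]
      simp [Branch.setBit, Branch.spend]; ring
    · intro b hb
      rw [h₂ b fun j hj => hb j (by omega)]
      exact Function.update_of_ne (hb t (by omega)) _ _
    · intro j hj
      rcases Nat.lt_succ_iff_lt_or_eq.1 hj with hj' | rfl
      · rw [h₃ j hj']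
        refine Function.update_of_ne (fun h => ?_) _ _
        have := C.inj j (by omega) (t + 1) ht h
        omega
      · rw [h₂ _ fun j' hj' h => ?_]
        · exact Function.update_self ..
        · have := C.inj (j + 1) ht (j' + 1) (by omega) h
          omega

/-- Increment the counter. -/
theorem exec_increment {w : ℕ} (φ : H) (U : Joint H d ≃ₗᵢ[ℂ] Joint H d) (C : Counter c M) (n : ℕ)
    (s : Branch H d w c) :
    ∃ μ : Fin c → Bool, exec φ U n (shift C.cnt M) s = [⟨μ, s.vec, s.calls, s.steps + (M + 1)⟩] ∧
      (∀ b ∉ C.scratch, μ b = s.mem b) ∧ μ C.flag = s.mem C.flag ∧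
      ∀ N, C.Shows s.mem N → C.Shows μ (N + 1) := by
  obtain ⟨μ, h₁, h₂, h₃⟩ := exec_shift φ U C n M le_rfl s
  refine ⟨μ, h₁, fun b hb => h₂ b ?_, h₂ _ ?_, fun N hN t ht => ?_⟩
  · rintro j hj rfl
    exact hb (C.cnt_mem hj)
  · exact fun j hj h => C.flag_ne _ hj h.symm
  · cases t with
    | zero =>
      rw [h₂ _ fun j hj h => ?_, hN 0 ht]
      · simp
      · have := C.inj 0 ht (j + 1) hj h
        omega
    | succ t => rw [h₃ t ht, hN t (by omega)]; simp

section Sample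

variable [NeZero d]

/-- Flip a coin whose bias is `sin² (k x)`, where `x` is the angle of outcome `i`; count if it shows
heads; then repeat the same rotation and measurement until the state is restored. -/
noncomputable def sample (C : Counter c M) (i : Fin d) (k : ℕ) : Prog d 3 c :=
  .seq (round i k C.flag) <| .seq (.ite C.flag (shift C.cnt M) .skip)
    (.while C.flag (round i k C.flag))

theorem size_sample_le (C : Counter c M) (i : Fin d) (k : ℕ) :
    (sample C i k).size ≤ 2 * ((k + 1) * (30 + 2 * Nat.clog 2 d)) + 2 * M + 6 := by
  have := size_round_le i k C.flag
  simp only [sample, Prog.size, size_shift]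
  omega

variable (φ : H) (U : Joint H d ≃ₗᵢ[ℂ] Joint H d)

/-- The bias of the coin. -/
noncomputable def coin (i : Fin d) (k : ℕ) : ℝ := Real.sin (k * angle φ U i) ^ 2

variable {φ} {i : Fin d} {k : ℕ}

theorem coin_nonneg : 0 ≤ coin φ U i k := sq_nonneg _

theorem coin_le_one : coin φ U i k ≤ 1 := Real.sin_sq_le_one _

theorem weight_clean (hφ : ‖φ‖ = 1) (s : Branch H d 3 c) (z : ℂ) (hs : s.vec = plane φ U i z 0) :
    s.weight = ‖z‖ ^ 2 := by
  rw [Branch.weight, hs, ← idle_eq_plane, Finset.sum_eq_single fun _ => false]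
  · simp [idle, norm_smul, norm_withFirst, hφ]
  · intro x _ hx
    simp [idle, Pi.single_eq_of_ne hx]
  · simp

theorem clean_iff (s : Branch H d 3 c) (i : Fin d) :
    Clean φ s ↔ ∃ z, s.vec = plane φ U i z 0 := by
  simp only [Clean, idle_eq_plane φ U i]

/-- From the undamaged state, the measurement fails with the probability of heads. -/
theorem exec_round_clean (hφ : ‖φ‖ = 1) (n : ℕ) (m : Fin c) (s : Branch H d 3 c) (z : ℂ)
    (hs : s.vec = plane φ U i z 0) :
    ∃ z₀ z₁ : ℂ, ‖z₀‖ ^ 2 = (1 - coin φ U i k) * ‖z‖ ^ 2 ∧ ‖z₁‖ ^ 2 = coin φ U i k * ‖z‖ ^ 2 ∧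
      exec φ U n (round i k m) s =
        [⟨Function.update s.mem m false, plane φ U i z₀ 0, s.calls + (4 * k + 2),
            s.steps + roundSteps d k⟩,
          ⟨Function.update s.mem m true, plane φ U i 0 z₁, s.calls + (4 * k + 2),
            s.steps + roundSteps d k⟩] := by
  refine ⟨_, _, ?_, ?_, exec_round U i hφ n k m s z 0 hs⟩
  · simp only [mul_zero, sub_zero, norm_mul, norm_pow, norm_neg, norm_one, one_pow, one_mul,
      Complex.norm_real, mul_pow, Real.norm_eq_abs, sq_abs, coin, Real.cos_sq']
  · simp only [mul_zero, add_zero, norm_mul, norm_pow, norm_neg, norm_one, one_pow, one_mul,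
      Complex.norm_real, mul_pow, Real.norm_eq_abs, sq_abs, coin]

/-- From the damaged state, the measurement restores with the probability of heads. -/
theorem exec_round_dirty (hφ : ‖φ‖ = 1) (n : ℕ) (m : Fin c) (s : Branch H d 3 c) (z : ℂ)
    (hs : s.vec = plane φ U i 0 z) :
    ∃ z₀ z₁ : ℂ, ‖z₀‖ ^ 2 = coin φ U i k * ‖z‖ ^ 2 ∧ ‖z₁‖ ^ 2 = (1 - coin φ U i k) * ‖z‖ ^ 2 ∧
      exec φ U n (round i k m) s =
        [⟨Function.update s.mem m false, plane φ U i z₀ 0, s.calls + (4 * k + 2),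
            s.steps + roundSteps d k⟩,
          ⟨Function.update s.mem m true, plane φ U i 0 z₁, s.calls + (4 * k + 2),
            s.steps + roundSteps d k⟩] := by
  refine ⟨_, _, ?_, ?_, exec_round U i hφ n k m s 0 z hs⟩
  · simp only [mul_zero, zero_sub, norm_mul, norm_pow, norm_neg, norm_one, one_pow, one_mul,
      Complex.norm_real, mul_pow, Real.norm_eq_abs, sq_abs, coin]
  · simp only [mul_zero, zero_add, norm_mul, norm_pow, norm_neg, norm_one, one_pow, one_mul,
      Complex.norm_real, mul_pow, Real.norm_eq_abs, sq_abs, coin, Real.cos_sq']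

/-- The loop that restores the state. -/
noncomputable def restore (φ : H) (U : Joint H d ≃ₗᵢ[ℂ] Joint H d) (i : Fin d) (k : ℕ) (m : Fin c)
    (N n : ℕ) : Branch H d 3 c → List (Branch H d 3 c) :=
  loop m (exec φ U N (round i k m)) n

theorem restore_done (m : Fin c) (N n : ℕ) (s : Branch H d 3 c) (hs : s.mem m = false) :
    restore φ U i k m N n s = if n = 0 then [] else [s.spend 1] := by
  cases n <;> simp [restore, loop, hs]

theorem restore_succ (hφ : ‖φ‖ = 1) (m : Fin c) (N n : ℕ) (s : Branch H d 3 c) (z : ℂ)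
    (hm : s.mem m = true) (hs : s.vec = plane φ U i 0 z) :
    ∃ (z₀ z₁ : ℂ) (s₀ s₁ : Branch H d 3 c),
      ‖z₀‖ ^ 2 = coin φ U i k * ‖z‖ ^ 2 ∧ ‖z₁‖ ^ 2 = (1 - coin φ U i k) * ‖z‖ ^ 2 ∧
      s₀ = ⟨Function.update s.mem m false, plane φ U i z₀ 0, s.calls + (4 * k + 2),
            s.steps + 1 + roundSteps d k⟩ ∧
      s₁ = ⟨Function.update s.mem m true, plane φ U i 0 z₁, s.calls + (4 * k + 2),
            s.steps + 1 + roundSteps d k⟩ ∧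
      restore φ U i k m N (n + 1) s =
        (if n = 0 then [] else [s₀.spend 1]) ++ restore φ U i k m N n s₁ := by
  obtain ⟨z₀, z₁, h₀, h₁, e⟩ := exec_round_dirty (k := k) U hφ N m (s.spend 1) z hs
  refine ⟨z₀, z₁, _, _, h₀, h₁, rfl, rfl, ?_⟩
  rw [← restore_done (φ := φ) U (k := k) (i := i) m N n _ (by simp)]
  simp only [restore, loop, hm, if_true, e]
  simp [Branch.spend]

theorem restore_support (hφ : ‖φ‖ = 1) (m : Fin c) (N n : ℕ) (s : Branch H d 3 c) (z : ℂ)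
    (hm : s.mem m = true) (hs : s.vec = plane φ U i 0 z) :
    ∀ t ∈ restore φ U i k m N n s, Clean φ t ∧ ∀ b ≠ m, t.mem b = s.mem b := by
  induction n generalizing s z with
  | zero => simp [restore, loop]
  | succ n ih =>
    obtain ⟨z₀, z₁, s₀, s₁, h₀, h₁, rfl, rfl, e⟩ := restore_succ (k := k) U hφ m N n s z hm hs
    intro t ht
    rw [e, List.mem_append] at ht
    rcases ht with ht | ht
    · split at ht
      · simp at ht
      · rw [List.mem_singleton] at ht
        subst ht
        exact ⟨(clean_iff U _ i).2 ⟨z₀, rfl⟩, fun b hb => Function.update_of_ne hb _ _⟩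
    · obtain ⟨h₂, h₃⟩ := ih _ z₁ (by simp) rfl t ht
      exact ⟨h₂, fun b hb => (h₃ b hb).trans (Function.update_of_ne hb _ _)⟩

theorem restore_mass (hφ : ‖φ‖ = 1) (m : Fin c) (N n : ℕ) (s : Branch H d 3 c) (z : ℂ)
    (hm : s.mem m = true) (hs : s.vec = plane φ U i 0 z) :
    wsum (restore φ U i k m N n s) (fun _ => 1) ≤ ‖z‖ ^ 2 := by
  induction n generalizing s z with
  | zero => simp [restore, loop]
  | succ n ih =>
    obtain ⟨z₀, z₁, s₀, s₁, h₀, h₁, rfl, hs₁, e⟩ := restore_succ (k := k) U hφ m N n s z hm hs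
    have h₂ := ih s₁ z₁ (by simp [hs₁]) (by rw [hs₁])
    rw [e, wsum_append]
    have h₃ : wsum (if n = 0 then [] else [Branch.spend ⟨Function.update s.mem m false,
        plane φ U i z₀ 0, s.calls + (4 * k + 2), s.steps + 1 + roundSteps d k⟩ 1])
        (fun _ => 1) ≤ ‖z₀‖ ^ 2 := by
      split
      · simp
      · rw [wsum_cons, wsum_nil, weight_clean (i := i) U hφ _ z₀ rfl]; simp
    linarith

/-- A flip damages the state with the probability `p` of heads, and each repetition restores it with
the same probability `p`.  So one repetition per flip is expected, however small `p` is. -/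
theorem restore_cost (hφ : ‖φ‖ = 1) {α β : ℝ} (hα : 0 ≤ α) (hβ : 0 ≤ β) (m : Fin c) (N n : ℕ)
    (s : Branch H d 3 c) (z : ℂ) {ω : ℝ} (hω : 0 ≤ ω) (hz : ‖z‖ ^ 2 = coin φ U i k * ω)
    (hm : s.mem m = true) (hs : s.vec = plane φ U i 0 z) :
    wsum (restore φ U i k m N n s) (cost α β) ≤ ω * (coin φ U i k * (cost α β s + β) +
      (α * (4 * k + 2 : ℕ) + β * (roundSteps d k + 1 : ℕ))) := by
  have hp := coin_nonneg U (φ := φ) (i := i) (k := k)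
  have hp' := coin_le_one U (φ := φ) (i := i) (k := k)
  have hcost : ∀ t : Branch H d 3 c, 0 ≤ cost α β t := fun t => by unfold cost; positivity
  induction n generalizing s z ω with
  | zero =>
    have := hcost s
    simp only [restore, loop, wsum_nil]
    positivity
  | succ n ih =>
    obtain ⟨z₀, z₁, s₀, s₁, h₀, h₁, hs₀, hs₁, e⟩ := restore_succ (k := k) U hφ m N n s z hm hs
    have h₂ := ih s₁ z₁ (ω := (1 - coin φ U i k) * ω) (by nlinarith) (by rw [h₁, hz]; ring)
      (by simp [hs₁]) (by simp [hs₁])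
    have h₃ : wsum (if n = 0 then [] else [s₀.spend 1]) (cost α β) ≤
        ‖z₀‖ ^ 2 * cost α β (s₀.spend 1) := by
      have := hcost (s₀.spend 1)
      split
      · rw [wsum_nil]; positivity
      · rw [wsum_cons, wsum_nil, weight_clean (i := i) U hφ _ z₀ (by simp [hs₀, Branch.spend])]
        simp
    have e₀ : cost α β (s₀.spend 1) = cost α β s + β +
        (α * (4 * k + 2 : ℕ) + β * (roundSteps d k + 1 : ℕ)) := by
      simp only [hs₀, cost, Branch.spend]; push_cast; ring
    have e₁ : cost α β s₁ = cost α β s + (α * (4 * k + 2 : ℕ) + β * (roundSteps d k + 1 : ℕ)) := by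
      simp only [hs₁, cost]; push_cast; ring
    rw [e₀, h₀, hz] at h₃
    rw [e₁] at h₂
    rw [e, wsum_append]
    refine (add_le_add h₃ h₂).trans (le_of_eq ?_)
    ring

theorem restore_halts (hφ : ‖φ‖ = 1) (m : Fin c) (N n : ℕ) (s : Branch H d 3 c) (z : ℂ)
    (hm : s.mem m = true) (hs : s.vec = plane φ U i 0 z) :
    ‖z‖ ^ 2 * (1 - (1 - coin φ U i k) ^ n) ≤ wsum (restore φ U i k m N (n + 1) s) fun _ => 1 := by
  induction n generalizing s z with
  | zero => simpa using wsum_nonneg fun _ _ => zero_le_one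
  | succ n ih =>
    obtain ⟨z₀, z₁, s₀, s₁, h₀, h₁, rfl, hs₁, e⟩ :=
      restore_succ (k := k) U hφ m N (n + 1) s z hm hs
    have h₂ := ih s₁ z₁ (by simp [hs₁]) (by rw [hs₁])
    rw [e, wsum_append, if_neg (Nat.succ_ne_zero n), wsum_cons, wsum_nil,
      weight_clean (i := i) U hφ _ z₀ rfl]
    rw [h₁] at h₂
    rw [h₀]
    refine le_trans (le_of_eq ?_) (add_le_add le_rfl h₂)
    ring

end Sample

section SampleSpec

variable {d c M : ℕ} {H : Type*} [NormedAddCommGroup H] [InnerProductSpace ℂ H] [NeZero d]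
  {φ : H} (U : Joint H d ≃ₗᵢ[ℂ] Joint H d) {i : Fin d} {k : ℕ}

theorem exec_sample (hφ : ‖φ‖ = 1) (C : Counter c M) (n : ℕ) (s : Branch H d 3 c) (z : ℂ)
    (hs : s.vec = plane φ U i z 0) :
    ∃ (z₀ z₁ : ℂ) (s₀ s₁ : Branch H d 3 c),
      ‖z₀‖ ^ 2 = (1 - coin φ U i k) * ‖z‖ ^ 2 ∧ ‖z₁‖ ^ 2 = coin φ U i k * ‖z‖ ^ 2 ∧
      s₀ = ⟨Function.update s.mem C.flag false, plane φ U i z₀ 0, s.calls + (4 * k + 2),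
        s.steps + roundSteps d k + 3⟩ ∧
      (s₁.vec = plane φ U i 0 z₁ ∧ s₁.calls = s.calls + (4 * k + 2) ∧
        s₁.steps = s.steps + roundSteps d k + (M + 2)) ∧
      (s₁.mem C.flag = true ∧ (∀ b ∉ C.scratch, s₁.mem b = s.mem b) ∧
        ∀ N, C.Shows s.mem N → C.Shows s₁.mem (N + 1)) ∧
      exec φ U n (sample C i k) s =
        (if n = 0 then [] else [s₀]) ++ restore φ U i k C.flag n n s₁ := by
  obtain ⟨z₀, z₁, h₀, h₁, e⟩ := exec_round_clean (k := k) U hφ n C.flag s z hs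
  obtain ⟨μ, hμ, hμ₁, hμ₂, hμ₃⟩ := exec_increment φ U C n (Branch.spend
    ⟨Function.update s.mem C.flag true, plane φ U i 0 z₁, s.calls + (4 * k + 2),
      s.steps + roundSteps d k⟩ 1)
  refine ⟨z₀, z₁, _, ⟨μ, plane φ U i 0 z₁, s.calls + (4 * k + 2),
    s.steps + roundSteps d k + (M + 2)⟩, h₀, h₁, rfl, ⟨rfl, rfl, rfl⟩, ⟨?_, ?_, ?_⟩, ?_⟩
  · simpa [Branch.spend] using hμ₂
  · intro b hb
    refine (hμ₁ b hb).trans ?_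
    exact Function.update_of_ne (C.ne_flag hb) _ _
  · intro N hN
    exact hμ₃ N (hN.congr fun b hb => Function.update_of_ne hb _ _)
  · simp only [sample, exec, e, List.flatMap_cons, List.flatMap_nil, List.append_nil,
      Function.update_self, if_true, hμ]
    have h := restore_done (φ := φ) U (k := k) (i := i) C.flag n n (Branch.spend
      (Branch.spend ⟨Function.update s.mem C.flag false, plane φ U i z₀ 0, s.calls + (4 * k + 2),
      s.steps + roundSteps d k⟩ 1) 1) (by simp [Branch.spend])
    simp only [restore] at h ⊢
    simp only [Bool.false_eq_true, if_false, List.flatMap_cons, List.flatMap_nil, List.append_nil,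
      h]
    congr 2
    simp [Branch.spend]; ring

theorem sample_support (hφ : ‖φ‖ = 1) (C : Counter c M) (n : ℕ) (s : Branch H d 3 c)
    (hs : Clean φ s) : ∀ t ∈ exec φ U n (sample C i k) s, Clean φ t ∧
      (∀ b ∉ C.scratch, t.mem b = s.mem b) ∧
      ∀ N, C.Shows s.mem N → C.Shows t.mem N ∨ C.Shows t.mem (N + 1) := by
  obtain ⟨z, hz⟩ := (clean_iff U s i).1 hs
  obtain ⟨z₀, z₁, s₀, s₁, h₀, h₁, hs₀, ⟨hv, -, -⟩, ⟨hf, hsc, hsh⟩, e⟩ :=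
    exec_sample (k := k) U hφ C n s z hz
  intro t ht
  rw [e, List.mem_append] at ht
  rcases ht with ht | ht
  · split at ht
    · simp at ht
    · rw [List.mem_singleton] at ht
      subst ht
      subst hs₀
      refine ⟨(clean_iff U _ i).2 ⟨z₀, rfl⟩, fun b hb => ?_, fun N hN => ?_⟩
      · exact Function.update_of_ne (C.ne_flag hb) _ _
      · exact Or.inl (hN.congr fun b hb => Function.update_of_ne hb _ _)
  · obtain ⟨h₂, h₃⟩ := restore_support U hφ C.flag n n s₁ z₁ hf hv t ht
    refine ⟨h₂, fun b hb => ?_, fun N hN => Or.inr ((hsh N hN).congr h₃)⟩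
    rw [h₃ b (C.ne_flag hb), hsc b hb]

/-- The number shown by the counter is raised with probability `coin φ U i k`. -/
theorem sample_coin (hφ : ‖φ‖ = 1) (C : Counter c M) (n : ℕ) (s : Branch H d 3 c)
    (hs : Clean φ s) {N : ℕ} (hN : C.Shows s.mem N) {G : (Fin c → Bool) → ℝ} {a b : ℝ}
    (ha : 0 ≤ a) (hb : 0 ≤ b)
    (hGa : ∀ μ, C.Shows μ N → (∀ b ∉ C.scratch, μ b = s.mem b) → G μ ≤ a)
    (hGb : ∀ μ, C.Shows μ (N + 1) → (∀ b ∉ C.scratch, μ b = s.mem b) → G μ ≤ b) :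
    wsum (exec φ U n (sample C i k) s) (fun t => G t.mem) ≤
      s.weight * ((1 - coin φ U i k) * a + coin φ U i k * b) := by
  obtain ⟨z, hz⟩ := (clean_iff U s i).1 hs
  obtain ⟨z₀, z₁, s₀, s₁, h₀, h₁, hs₀, ⟨hv, -, -⟩, ⟨hf, hsc, hsh⟩, e⟩ :=
    exec_sample (k := k) U hφ C n s z hz
  rw [e, wsum_append, weight_clean U hφ s z hz]
  have e₀ : wsum (if n = 0 then [] else [s₀]) (fun t => G t.mem) ≤ ‖z₀‖ ^ 2 * a := by
    split
    · rw [wsum_nil]; positivity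
    · subst hs₀
      rw [wsum_cons, wsum_nil, weight_clean (i := i) U hφ _ z₀ rfl, add_zero]
      refine mul_le_mul_of_nonneg_left (hGa _ ?_ ?_) (by positivity)
      · exact hN.congr fun b hb => Function.update_of_ne hb _ _
      · exact fun b hb => Function.update_of_ne (C.ne_flag hb) _ _
  have e₁ : wsum (restore φ U i k C.flag n n s₁) (fun t => G t.mem) ≤ ‖z₁‖ ^ 2 * b := by
    refine (wsum_mono (G₂ := fun _ => b) fun t ht => ?_).trans ?_
    · obtain ⟨-, h₃⟩ := restore_support U hφ C.flag n n s₁ z₁ hf hv t ht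
      exact hGb _ ((hsh N hN).congr h₃) fun b hb => by rw [h₃ b (C.ne_flag hb), hsc b hb]
    · rw [wsum_const, mul_comm]
      exact mul_le_mul_of_nonneg_right (restore_mass U hφ C.flag n n s₁ z₁ hf hv) hb
  rw [h₀] at e₀
  rw [h₁] at e₁
  linarith

theorem exists_mul_pow_le {p η : ℝ} (h0 : 0 ≤ p) (h1 : p ≤ 1) (hη : η < 1) :
    ∃ N : ℕ, ∀ n ≥ N, p * (1 - p) ^ n ≤ 1 - η := by
  rcases h0.eq_or_lt with rfl | hp
  · exact ⟨0, fun n _ => by simp; linarith⟩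
  · obtain ⟨N, hN⟩ := exists_pow_lt_of_lt_one (show 0 < 1 - η by linarith)
      (show 1 - p < 1 by linarith)
    refine ⟨N, fun n hn => ?_⟩
    have h₂ := pow_le_pow_of_le_one (show 0 ≤ 1 - p by linarith) (by linarith) hn
    have h₃ : 0 ≤ (1 - p) ^ n := pow_nonneg (by linarith) n
    nlinarith

theorem sample_reliable (hφ : ‖φ‖ = 1) (C : Counter c M) (i : Fin d) (k : ℕ) :
    Reliable φ U (sample C i k) C.scratch (2 * (4 * k + 2)) (2 * roundSteps d k + M + 4) where
  clean n s hs t ht := (sample_support U hφ C n s hs t ht).1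
  frame G hG hS n s hs := by
    obtain ⟨z, hz⟩ := (clean_iff U s i).1 hs
    have h₁ : wsum (exec φ U n (sample C i k) s) (fun t => G t.mem) ≤
        wsum (exec φ U n (sample C i k) s) fun _ => G s.mem := wsum_mono fun t ht =>
      (hS _ _ (sample_support U hφ C n s hs t ht).2.1).le
    refine h₁.trans ?_
    obtain ⟨z₀, z₁, s₀, s₁, h₀, h₁, hs₀, ⟨hv, -, -⟩, ⟨hf, -, -⟩, e⟩ :=
      exec_sample (k := k) U hφ C n s z hz
    rw [wsum_const, mul_comm]
    refine mul_le_mul_of_nonneg_right ?_ (hG _)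
    have e₀ : wsum (if n = 0 then [] else [s₀]) (fun t => 1) ≤ ‖z₀‖ ^ 2 := by
      split
      · rw [wsum_nil]; positivity
      · rw [wsum_cons, wsum_nil, weight_clean (i := i) U hφ _ z₀ (by rw [hs₀])]; simp
    have e₁ := restore_mass (k := k) U hφ C.flag n n s₁ z₁ hf hv
    rw [e, wsum_append, weight_clean U hφ s z hz]
    linarith
  halts η h0 h1 := by
    obtain ⟨N, hN⟩ := exists_mul_pow_le (coin_nonneg U (φ := φ) (i := i) (k := k))
      (coin_le_one U) h1
    refine ⟨N + 1, fun n hn s hs => ?_⟩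
    obtain ⟨n, rfl⟩ : ∃ n', n = n' + 1 := ⟨n - 1, by omega⟩
    obtain ⟨z, hz⟩ := (clean_iff U s i).1 hs
    obtain ⟨z₀, z₁, s₀, s₁, h₀, h₁, hs₀, ⟨hv, -, -⟩, ⟨hf, -, -⟩, e⟩ :=
      exec_sample (k := k) U hφ C (n + 1) s z hz
    have e₁ := restore_halts (k := k) U hφ C.flag (n + 1) n s₁ z₁ hf hv
    rw [e, wsum_append, weight_clean U hφ s z hz, if_neg n.succ_ne_zero, wsum_cons, wsum_nil,
      weight_clean (i := i) U hφ _ z₀ (by rw [hs₀]), h₀]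
    rw [h₁] at e₁
    have h₂ := mul_le_mul_of_nonneg_left (hN n (by omega)) (sq_nonneg ‖z‖)
    linarith
  cost_le α β hα hβ n s hs := by
    obtain ⟨z, hz⟩ := (clean_iff U s i).1 hs
    obtain ⟨z₀, z₁, s₀, s₁, h₀, h₁, hs₀, ⟨hv, hcl, hst⟩, ⟨hf, -, -⟩, e⟩ :=
      exec_sample (k := k) U hφ C n s z hz
    have hp := coin_nonneg U (φ := φ) (i := i) (k := k)
    have hp' := coin_le_one U (φ := φ) (i := i) (k := k)
    have hcost : ∀ t : Branch H d 3 c, 0 ≤ cost α β t := fun t => by unfold cost; positivity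
    have e₀ : wsum (if n = 0 then [] else [s₀]) (cost α β) ≤ ‖z₀‖ ^ 2 * cost α β s₀ := by
      have := hcost s₀
      split
      · rw [wsum_nil]; positivity
      · rw [wsum_cons, wsum_nil, weight_clean (i := i) U hφ _ z₀ (by rw [hs₀])]; simp
    have e₁ := restore_cost U hφ hα hβ C.flag n n s₁ z₁ (sq_nonneg ‖z‖) h₁ hf hv
    have c₀ : cost α β s₀ = cost α β s + (α * (4 * k + 2 : ℕ) + β * (roundSteps d k)) + 3 * β := by
      simp only [hs₀, cost]; push_cast; ring
    have c₁ : cost α β s₁ = cost α β s + (α * (4 * k + 2 : ℕ) + β * (roundSteps d k)) +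
        (M + 2) * β := by
      simp only [hcl, hst, cost]; push_cast; ring
    rw [h₀, c₀] at e₀
    rw [c₁] at e₁
    rw [e, wsum_append, weight_clean U hφ s z hz]
    refine (add_le_add e₀ e₁).trans ?_
    have h₂ : 0 ≤ ‖z‖ ^ 2 * ((1 - coin φ U i k) * (M * β)) := by
      have := sub_nonneg.2 hp'
      positivity
    push_cast at *
    linarith

end SampleSpec

/-! ### Comparing the bias of a coin with a threshold -/

/-- Write constants to classical bits. -/
def writes {d w c : ℕ} (l : List (Fin c × Bool)) : Prog d w c :=
  seqs (l.map fun a => .assign a.1 (fun _ _ => a.2) a.1 a.1)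

theorem size_writes {d w c : ℕ} (l : List (Fin c × Bool)) :
    (writes l : Prog d w c).size ≤ 2 * l.length + 1 := by
  have := size_seqs_le (b := 1) (l := l.map fun a : Fin c × Bool =>
    (Prog.assign a.1 (fun _ _ => a.2) a.1 a.1 : Prog d w c)) fun p hp => by
      obtain ⟨a, -, rfl⟩ := List.mem_map.1 hp
      exact le_rfl
  simp only [List.length_map] at this
  simp only [writes]
  omega

section Writes

variable {d c : ℕ} {H : Type*} [NormedAddCommGroup H] [InnerProductSpace ℂ H]

theorem exec_writes {w : ℕ} (φ : H) (U : Joint H d ≃ₗᵢ[ℂ] Joint H d) (n : ℕ)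
    (l : List (Fin c × Bool)) (s : Branch H d w c) :
    ∃ μ : Fin c → Bool,
      exec φ U n (writes l) s = [⟨μ, s.vec, s.calls, s.steps + (l.length + 1)⟩] ∧
      (∀ b ∉ l.map Prod.fst, μ b = s.mem b) ∧
      ((l.map Prod.fst).Nodup → ∀ a ∈ l, μ a.1 = a.2) := by
  induction l generalizing s with
  | nil => exact ⟨s.mem, rfl, fun _ _ => rfl, by simp⟩
  | cons a l ih =>
    obtain ⟨μ, h₁, h₂, h₃⟩ := ih ((s.spend 1).setBit a.1 a.2)
    refine ⟨μ, ?_, fun b hb => ?_, fun hl a' ha' => ?_⟩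
    · simp only [writes, List.map_cons, seqs, exec, List.flatMap_cons, List.flatMap_nil,
        List.append_nil]
      refine Eq.trans h₁ ?_
      simp [Branch.setBit, Branch.spend]; ring
    · simp only [List.map_cons, List.mem_cons, not_or] at hb
      rw [h₂ b hb.2]
      exact Function.update_of_ne hb.1 _ _
    · simp only [List.map_cons, List.nodup_cons] at hl
      rcases List.mem_cons.1 ha' with rfl | ha'
      · rw [h₂ _ hl.1]
        exact Function.update_self ..
      · exact h₃ hl.2 a' ha'

theorem writes_reliable [NeZero d] (φ : H) (U : Joint H d ≃ₗᵢ[ℂ] Joint H d)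
    (l : List (Fin c × Bool)) {S : Set (Fin c)} (hS : ∀ a ∈ l, a.1 ∈ S) :
    Reliable φ U (writes l) S 0 (l.length + 1) :=
  .of_classical fun n s => by
    obtain ⟨μ, h₁, h₂, -⟩ := exec_writes φ U n l s
    refine ⟨μ, fun k hk => h₂ k fun h => ?_, h₁⟩
    obtain ⟨a, ha, rfl⟩ := List.mem_map.1 h
    exact hk (hS a ha)

end Writes

section Test

variable {d c M : ℕ} [NeZero d]

/-- Set the counter to zero. -/
def reset {d w : ℕ} (C : Counter c M) : Prog d w c :=
  writes ((List.range (M + 1)).map fun t => (C.cnt t, decide (t ≤ 0)))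

/-- Count the heads among `R` flips of the coin. -/
noncomputable def flips (C : Counter c M) (i : Fin d) (k R : ℕ) : Prog d 3 c :=
  .seq (reset C) (seqs (List.replicate R (sample C i k)))

theorem size_flips_le (C : Counter c M) (i : Fin d) {k R K : ℕ} (hk : k ≤ K) (hR : R ≤ M) :
    (flips C i k R).size ≤
      2 * M + 5 + M * (2 * ((K + 1) * (30 + 2 * Nat.clog 2 d)) + 2 * M + 7) := by
  have h₁ := size_writes (d := d) (w := 3)
    ((List.range (M + 1)).map fun t => (C.cnt t, decide (t ≤ 0)))
  have h₂ := size_seqs_le (l := List.replicate R (sample C i k)) (b := _) (by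
    simpa using fun _ => size_sample_le C i k)
  simp only [List.length_map, List.length_range] at h₁
  simp only [List.length_replicate] at h₂
  have h₃ : R * (2 * ((k + 1) * (30 + 2 * Nat.clog 2 d)) + 2 * M + 6 + 1) ≤
      M * (2 * ((K + 1) * (30 + 2 * Nat.clog 2 d)) + 2 * M + 7) := by
    have : (k + 1) * (30 + 2 * Nat.clog 2 d) ≤ (K + 1) * (30 + 2 * Nat.clog 2 d) := by gcongr
    exact Nat.mul_le_mul hR (by linarith)
  simp only [flips, Prog.size, reset]
  omega

variable {H : Type*} [NormedAddCommGroup H] [InnerProductSpace ℂ H]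
  {φ : H} (U : Joint H d ≃ₗᵢ[ℂ] Joint H d)

theorem flips_reliable (hφ : ‖φ‖ = 1) (C : Counter c M) (i : Fin d) (k R : ℕ) :
    Reliable φ U (flips C i k R) C.scratch (R * (2 * (4 * k + 2)))
      (M + 2 + (R * (2 * roundSteps d k + M + 4) + 1)) := by
  refine Reliable.mono ((writes_reliable φ U _ ?_).seq (Reliable.seqs (A := 2 * (4 * k + 2))
    (B := 2 * roundSteps d k + M + 4) ?_)) subset_rfl ?_ ?_
  · intro a ha
    obtain ⟨t, ht, rfl⟩ := List.mem_map.1 ha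
    exact C.cnt_mem (by simp at ht; omega)
  · intro p hp
    rw [List.eq_of_mem_replicate hp]
    exact sample_reliable U hφ C i k
  · simp
  · simp

/-- Exponential moments of the number of heads. -/
theorem samples_moment (hφ : ‖φ‖ = 1) (C : Counter c M) (i : Fin d) (k R n : ℕ)
    (s : Branch H d 3 c) (hs : Clean φ s) {N : ℕ} (hN : C.Shows s.mem N) (hR : N + R ≤ M)
    {G : (Fin c → Bool) → ℝ} {a y : ℝ} (ha : 0 ≤ a) (hy : 0 ≤ y)
    (hG : ∀ μ N', C.Shows μ N' → G μ ≤ a * y ^ N') :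
    wsum (exec φ U n (seqs (List.replicate R (sample C i k))) s) (fun t => G t.mem) ≤
      s.weight * (a * (1 - coin φ U i k + coin φ U i k * y) ^ R * y ^ N) := by
  have hp := coin_nonneg U (φ := φ) (i := i) (k := k)
  have hp' := sub_nonneg.2 (coin_le_one U (φ := φ) (i := i) (k := k))
  induction R generalizing s N with
  | zero =>
    simp only [List.replicate_zero, seqs, exec, wsum_cons, wsum_nil, add_zero, pow_zero, mul_one]
    exact mul_le_mul_of_nonneg_left (hG _ N hN) s.weight_nonneg
  | succ R ih =>
    set r := 1 - coin φ U i k + coin φ U i k * y with hr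
    have hr0 : 0 ≤ r := by positivity
    classical
    refine (wsum_flatMap_le (F := fun t => if C.Shows t.mem N then a * r ^ R * y ^ N
      else a * r ^ R * y ^ (N + 1)) fun t ht => ?_).trans ?_
    · obtain ⟨h₁, -, h₂⟩ := sample_support U hφ C n s hs t ht
      split_ifs with h
      · exact ih t h₁ h (by omega)
      · exact ih t h₁ ((h₂ N hN).resolve_left h) (by omega)
    · refine (sample_coin U hφ C n s hs hN (a := a * r ^ R * y ^ N) (b := a * r ^ R * y ^ (N + 1))
        (by positivity) (by positivity) (G := fun μ => if C.Shows μ N then a * r ^ R * y ^ N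
        else a * r ^ R * y ^ (N + 1)) ?_ ?_).trans (le_of_eq ?_)
      · intro μ hμ _
        rw [if_pos hμ]
      · intro μ hμ _
        rw [if_neg (hμ.not_shows_succ (by omega))]
      · simp only [hr]; ring

theorem bernoulli_moment_le {p t : ℝ} (hp : 0 ≤ p) (hp' : p ≤ 1) (ht : |t| ≤ 1) :
    1 - p + p * Real.exp t ≤ Real.exp (p * t + t ^ 2) := by
  have h₁ : Real.exp t ≤ 1 + t + t ^ 2 := by
    have := (abs_le.1 (Real.abs_exp_sub_one_sub_id_le ht)).2
    linarith
  have h₂ := Real.add_one_le_exp (p * t + t ^ 2)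
  nlinarith [mul_le_mul_of_nonneg_left h₁ hp, mul_nonneg (sub_nonneg.2 hp') (sq_nonneg t)]

/-- Chernoff's bound for the number of heads, in both directions according to the sign of `t`. -/
theorem flips_chernoff (hφ : ‖φ‖ = 1) (C : Counter c M) (i : Fin d) {k R : ℕ} (hR : R ≤ M) (n : ℕ)
    (s : Branch H d 3 c) (hs : Clean φ s) {τ t : ℝ} (ht : |t| ≤ 1)
    {G : (Fin c → Bool) → ℝ}
    (hG : ∀ μ N, C.Shows μ N → G μ ≤ Real.exp (t * (N - τ * R))) :
    wsum (exec φ U n (flips C i k R) s) (fun t => G t.mem) ≤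
      s.weight * Real.exp (R * (t * (coin φ U i k - τ) + t ^ 2)) := by
  have hp := coin_nonneg U (φ := φ) (i := i) (k := k)
  have hp' := coin_le_one U (φ := φ) (i := i) (k := k)
  obtain ⟨μ, h₁, -, h₂⟩ := exec_writes φ U n
    ((List.range (M + 1)).map fun t => (C.cnt t, decide (t ≤ 0))) s
  have h₃ : C.Shows μ 0 := by
    intro j hj
    refine h₂ ?_ (C.cnt j, decide (j ≤ 0))
      (List.mem_map.2 ⟨j, List.mem_range.2 (by omega), rfl⟩)
    rw [List.map_map]
    refine List.Nodup.map_on ?_ List.nodup_range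
    intro a ha b hb h
    exact C.inj a (by simp at ha; omega) b (by simp at hb; omega) h
  simp only [flips, exec, reset, h₁, List.flatMap_cons, List.flatMap_nil, List.append_nil]
  refine (samples_moment U hφ C i k R n _ (by exact hs) h₃ (by omega)
    (a := Real.exp (-(t * τ * R))) (y := Real.exp t) (by positivity) (by positivity) ?_).trans ?_
  · intro μ N hμ
    rw [← Real.exp_nat_mul, ← Real.exp_add]
    refine (hG μ N hμ).trans (le_of_eq ?_)
    congr 1; ring
  · refine mul_le_mul_of_nonneg_left ?_ s.weight_nonneg
    have h₄ : (1 - coin φ U i k + coin φ U i k * Real.exp t) ^ R ≤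
        Real.exp (coin φ U i k * t + t ^ 2) ^ R :=
      pow_le_pow_left₀ (by have := Real.exp_pos t; nlinarith) (bernoulli_moment_le hp hp' ht) R
    rw [pow_zero, mul_one]
    refine (mul_le_mul_of_nonneg_left h₄ (Real.exp_pos _).le).trans (le_of_eq ?_)
    rw [← Real.exp_nat_mul, ← Real.exp_add]
    congr 1; ring

/-- If the bias of the coin is below the threshold `τ` by at least `g`, the count of heads hardly
ever reaches `τ R`. -/
theorem flips_low (hφ : ‖φ‖ = 1) (C : Counter c M) (i : Fin d) {k R : ℕ} (hR : R ≤ M) (n : ℕ)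
    (s : Branch H d 3 c) (hs : Clean φ s) {τ g : ℝ} (hg : 0 ≤ g) (hg' : g ≤ 1) (hτ : τ ≤ 1)
    (h : coin φ U i k ≤ τ - g) :
    wsum (exec φ U n (flips C i k R) s) (fun t => if t.mem (C.cnt ⌈τ * R⌉₊) then 1 else 0) ≤
      s.weight * Real.exp (-(g ^ 2 / 4 * R)) := by
  refine (flips_chernoff U hφ C i hR n s hs (τ := τ) (t := g / 2)
    (by rw [abs_of_nonneg] <;> linarith)
    (G := fun μ => if μ (C.cnt ⌈τ * R⌉₊) then 1 else 0) ?_).trans ?_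
  · intro μ N hμ
    have hT : ⌈τ * R⌉₊ ≤ M := (Nat.ceil_le.2 (by nlinarith [Nat.cast_nonneg (α := ℝ) R])).trans hR
    rw [hμ _ hT]
    simp only [decide_eq_true_eq]
    split_ifs with hN
    · refine Real.one_le_exp (mul_nonneg (by linarith) ?_)
      have := Nat.ceil_le.1 hN
      linarith
    · exact (Real.exp_pos _).le
  · refine mul_le_mul_of_nonneg_left (Real.exp_le_exp.2 ?_) s.weight_nonneg
    have : g / 2 * (coin φ U i k - τ) + (g / 2) ^ 2 ≤ -(g ^ 2 / 4) := by nlinarith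
    have := mul_le_mul_of_nonneg_left this (Nat.cast_nonneg (α := ℝ) R)
    linarith

/-- If the bias of the coin is above the threshold `τ` by at least `g`, the count of heads hardly
ever stays below `τ R`. -/
theorem flips_high (hφ : ‖φ‖ = 1) (C : Counter c M) (i : Fin d) {k R : ℕ} (hR : R ≤ M) (n : ℕ)
    (s : Branch H d 3 c) (hs : Clean φ s) {τ g : ℝ} (hg : 0 ≤ g) (hg' : g ≤ 1) (hτ : τ ≤ 1)
    (h : τ + g ≤ coin φ U i k) :
    wsum (exec φ U n (flips C i k R) s) (fun t => if t.mem (C.cnt ⌈τ * R⌉₊) then 0 else 1) ≤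
      s.weight * Real.exp (-(g ^ 2 / 4 * R)) := by
  refine (flips_chernoff U hφ C i hR n s hs (τ := τ) (t := -(g / 2))
    (by rw [abs_neg, abs_of_nonneg] <;> linarith)
    (G := fun μ => if μ (C.cnt ⌈τ * R⌉₊) then 0 else 1) ?_).trans ?_
  · intro μ N hμ
    have hT : ⌈τ * R⌉₊ ≤ M := (Nat.ceil_le.2 (by nlinarith [Nat.cast_nonneg (α := ℝ) R])).trans hR
    rw [hμ _ hT]
    simp only [decide_eq_true_eq]
    split_ifs with hN
    · exact (Real.exp_pos _).le
    · refine Real.one_le_exp (mul_nonneg_of_nonpos_of_nonpos (by linarith) ?_)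
      have := Nat.lt_ceil.1 (not_le.1 hN)
      linarith
  · refine mul_le_mul_of_nonneg_left (Real.exp_le_exp.2 ?_) s.weight_nonneg
    have : -(g / 2) * (coin φ U i k - τ) + (-(g / 2)) ^ 2 ≤ -(g ^ 2 / 4) := by nlinarith
    have := mul_le_mul_of_nonneg_left this (Nat.cast_nonneg (α := ℝ) R)
    linarith

end Test

/-! ### Splitting an interval of angles by the bias of a coin -/

open Real in
/-- The interval `[l, l + Δ]` can be stretched by an integer to a constant length without leaving
a single quadrant.  If the least stretch `K` to a constant length does not do, the stretched
interval contains a multiple of `π / 2`, and raising the factor until its left end has passed this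
multiple is enough, since `l` is then large compared to `Δ`. -/
theorem exists_multiplier {l Δ : ℝ} (hl : 0 ≤ l) (hΔ : 0 < Δ) (h : l + Δ ≤ π / 3) :
    ∃ k j : ℕ, 1 ≤ k ∧ j * (π / 2) ≤ k * l ∧ k * (l + Δ) ≤ (j + 1) * (π / 2) ∧ π / 16 ≤ k * Δ := by
  have hπ := pi_pos
  rcases le_or_gt (π / 16) Δ with h₁ | h₁
  · exact ⟨1, 0, le_rfl, by simpa using hl, by push_cast; linarith, by push_cast; linarith⟩
  obtain ⟨K, hK⟩ : ∃ K, K = ⌈π / 16 / Δ⌉₊ := ⟨_, rfl⟩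
  have hK₁ : π / 16 ≤ K * Δ := by
    rw [← div_le_iff₀ hΔ, hK]; exact Nat.le_ceil _
  have hK₂ : K * Δ ≤ π / 8 := by
    have : (K : ℝ) < π / 16 / Δ + 1 := by rw [hK]; exact Nat.ceil_lt_add_one (by positivity)
    have := mul_lt_mul_of_pos_right this hΔ
    rw [add_mul, div_mul_cancel₀ _ hΔ.ne'] at this
    linarith
  have hK₃ : 1 ≤ K := by
    rcases Nat.eq_zero_or_pos K with h0 | h0
    · rw [h0, Nat.cast_zero] at hK₁; linarith
    · exact h0
  obtain ⟨j, hj⟩ : ∃ j, j = ⌊K * l / (π / 2)⌋₊ := ⟨_, rfl⟩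
  have hj₁ : j * (π / 2) ≤ K * l := by
    rw [← le_div_iff₀ (by positivity), hj]; exact Nat.floor_le (by positivity)
  by_cases h₂ : K * (l + Δ) ≤ (j + 1) * (π / 2)
  · exact ⟨K, j, hK₃, hj₁, h₂, hK₁⟩
  push Not at h₂
  have hj0 : (0 : ℝ) ≤ j := Nat.cast_nonneg j
  have h₃ : 3 * π / 8 < K * l := by nlinarith
  have hl' : 0 < l := by
    rcases hl.eq_or_lt with h0 | h0
    · rw [← h0, mul_zero] at h₃; linarith
    · exact h0
  have hj₂ : K * l < (j + 1) * (π / 2) := by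
    rw [← div_lt_iff₀ (by positivity), hj]; exact Nat.lt_floor_add_one _
  obtain ⟨k, hk⟩ : ∃ k, k = ⌈(j + 1) * (π / 2) / l⌉₊ := ⟨_, rfl⟩
  have hk₁ : (j + 1) * (π / 2) ≤ k * l := by
    rw [← div_le_iff₀ hl', hk]; exact Nat.le_ceil _
  have hk₂ : k * l < (j + 1) * (π / 2) + l := by
    have : (k : ℝ) < (j + 1) * (π / 2) / l + 1 := by
      rw [hk]; exact Nat.ceil_lt_add_one (by positivity)
    have := mul_lt_mul_of_pos_right this hl'
    rwa [add_mul, div_mul_cancel₀ _ hl'.ne', one_mul] at this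
  have hKk : (K : ℝ) ≤ k := le_of_mul_le_mul_right (by linarith : (K : ℝ) * l ≤ k * l) hl'
  have hΔl : Δ ≤ l / 3 := by
    have hK0 : (0 : ℝ) < K := by exact_mod_cast hK₃
    have : K * Δ ≤ K * (l / 3) := by linarith
    exact le_of_mul_le_mul_left this hK0
  have h₄ : (k - K - 1) * Δ ≤ π / 24 := by
    rcases le_or_gt ((k : ℝ) - K - 1) 0 with h0 | h0
    · nlinarith
    · have : (k - K - 1) * Δ ≤ (k - K - 1) * (l / 3) := by gcongr
      nlinarith
  refine ⟨k, j + 1, hK₃.trans (by exact_mod_cast hKk), by push_cast; exact hk₁, ?_, ?_⟩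
  · push_cast
    nlinarith
  · exact hK₁.trans (mul_le_mul_of_nonneg_right hKk hΔ.le)

open Real in
theorem sin_ge_of_mem {a : ℝ} (h₁ : π / 32 ≤ a) (h₂ : a ≤ π - π / 32) : 1 / 16 ≤ sin a := by
  have hπ := pi_pos
  rcases le_total a (π / 2) with h | h
  · refine le_trans ?_ (mul_le_sin (by linarith) h)
    rw [div_mul_eq_mul_div, le_div_iff₀ hπ]; linarith
  · rw [← sin_pi_sub]
    refine le_trans ?_ (mul_le_sin (by linarith) (by linarith))
    rw [div_mul_eq_mul_div, le_div_iff₀ hπ]; linarith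

theorem sin_sq_sub_sin_sq (a b : ℝ) :
    Real.sin a ^ 2 - Real.sin b ^ 2 = Real.sin (a + b) * Real.sin (a - b) := by
  rw [Real.sin_add, Real.sin_sub]
  have h₁ := Real.sin_sq_add_cos_sq a
  have h₂ := Real.sin_sq_add_cos_sq b
  linear_combination (Real.sin b ^ 2) * h₁ - (Real.sin a ^ 2) * h₂

open Real in
/-- Inside one quadrant, `sin²` separates the outer thirds of the interval from its middle: the
difference of two values of `sin²` is a product of two sines, which are at least `1 / 16` and
`1 / 48` in absolute value. -/
theorem sin_sq_gap {l Δ x : ℝ} {k j : ℕ} (h₁ : j * (π / 2) ≤ k * l)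
    (h₂ : k * (l + Δ) ≤ (j + 1) * (π / 2)) (h₃ : π / 16 ≤ k * Δ) (hl : l ≤ x) (hx : x ≤ l + Δ) :
    (l + 2 * Δ / 3 ≤ x →
      1 / 768 ≤ (-1) ^ j * (sin (k * x) ^ 2 - sin (k * (l + Δ / 2)) ^ 2)) ∧
    (x ≤ l + Δ / 3 →
      (-1) ^ j * (sin (k * x) ^ 2 - sin (k * (l + Δ / 2)) ^ 2) ≤ -(1 / 768)) := by
  have hπ := pi_pos
  have hk : (0 : ℝ) ≤ k := Nat.cast_nonneg k
  have e : (-1 : ℝ) ^ j * (sin (k * x) ^ 2 - sin (k * (l + Δ / 2)) ^ 2) =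
      sin (k * x + k * (l + Δ / 2) - j * π) * sin (k * (x - (l + Δ / 2))) := by
    rw [sin_sq_sub_sin_sq, sin_sub_nat_mul_pi, ← mul_sub, mul_assoc]
  have hkl : k * l ≤ k * x := by gcongr
  have hkx : k * x ≤ k * (l + Δ) := by gcongr
  have h₄ : 1 / 16 ≤ sin (k * x + k * (l + Δ / 2) - j * π) :=
    sin_ge_of_mem (by linarith) (by linarith)
  have h₅ : ∀ y, π / 96 ≤ y → y ≤ π / 4 → 1 / 48 ≤ sin y := by
    intro y hy hy'
    refine le_trans ?_ (mul_le_sin (by linarith) (by linarith))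
    rw [div_mul_eq_mul_div, le_div_iff₀ hπ]; linarith
  rw [e]
  constructor
  · intro h
    have h' : k * (l + 2 * Δ / 3) ≤ k * x := by gcongr
    have h₆ := h₅ (k * (x - (l + Δ / 2))) (by linarith) (by linarith)
    nlinarith
  · intro h
    have h' : k * x ≤ k * (l + Δ / 3) := by gcongr
    have h₆ := h₅ (-(k * (x - (l + Δ / 2)))) (by linarith) (by linarith)
    rw [sin_neg] at h₆
    nlinarith

/-- A test that shrinks an interval for the unknown angle to two thirds of its length: a coin with
bias `sin² (k x)`, a threshold `τ` for its bias, and the left ends `l₁`, `l₀` of the interval that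
is kept if the bias seems to be above, or below, the threshold. -/
structure Split where
  k : ℕ
  τ : ℝ
  l₁ : ℝ
  l₀ : ℝ

/-- The test is applicable to `[l, l + Δ]`: the bias is far from the threshold, on the right side,
wherever one of the two answers is wrong. -/
structure Split.Works (D : Split) (l Δ : ℝ) : Prop where
  one_le : 1 ≤ D.k
  mul_le : D.k * Δ ≤ Real.pi / 2
  τ_le : D.τ ≤ 1
  le₁ : l ≤ D.l₁
  le₁' : D.l₁ ≤ l + Δ / 3
  le₀ : l ≤ D.l₀
  le₀' : D.l₀ ≤ l + Δ / 3
  low : ∀ x, l ≤ x → x ≤ l + Δ → (D.l₁ ≤ x → D.l₁ + 2 * Δ / 3 < x) →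
    Real.sin (D.k * x) ^ 2 ≤ D.τ - 1 / 768
  high : ∀ x, l ≤ x → x ≤ l + Δ → (D.l₀ ≤ x → D.l₀ + 2 * Δ / 3 < x) →
    D.τ + 1 / 768 ≤ Real.sin (D.k * x) ^ 2

theorem exists_split (l Δ : ℝ) :
    ∃ D : Split, 0 ≤ l → 0 < Δ → l + Δ ≤ Real.pi / 3 → D.Works l Δ := by
  by_cases h : 0 ≤ l ∧ 0 < Δ ∧ l + Δ ≤ Real.pi / 3
  swap
  · exact ⟨⟨0, 0, 0, 0⟩, fun h₁ h₂ h₃ => absurd ⟨h₁, h₂, h₃⟩ h⟩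
  obtain ⟨hl, hΔ, h⟩ := h
  obtain ⟨k, j, hk, h₁, h₂, h₃⟩ := exists_multiplier hl hΔ h
  have key := fun x => sin_sq_gap (x := x) h₁ h₂ h₃
  have hτ := Real.sin_sq_le_one (k * (l + Δ / 2))
  have hkΔ : k * Δ ≤ Real.pi / 2 := by linarith
  -- on quadrants with odd number, `sin²` is decreasing
  rcases j.even_or_odd with hj | hj
  · simp only [hj.neg_one_pow, one_mul] at key
    refine ⟨⟨k, Real.sin (k * (l + Δ / 2)) ^ 2, l + Δ / 3, l⟩, fun _ _ _ =>
      ⟨hk, hkΔ, hτ, ?_, ?_, ?_, ?_, fun x hx hx' hn => ?_, fun x hx hx' hn => ?_⟩⟩ <;>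
      simp only at *
    · linarith
    · linarith
    · linarith
    · linarith
    · have := (key x hx hx').2 (by by_contra! h0; linarith [hn h0.le])
      linarith
    · have := (key x hx hx').1 (hn hx).le
      linarith
  · simp only [hj.neg_one_pow] at key
    refine ⟨⟨k, Real.sin (k * (l + Δ / 2)) ^ 2, l, l + Δ / 3⟩, fun _ _ _ =>
      ⟨hk, hkΔ, hτ, ?_, ?_, ?_, ?_, fun x hx hx' hn => ?_, fun x hx hx' hn => ?_⟩⟩ <;>
      simp only at *
    · linarith
    · linarith
    · linarith
    · linarith
    · have := (key x hx hx').1 (hn hx).le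
      linarith
    · have := (key x hx hx').2 (by by_contra! h0; linarith [hn h0.le])
      linarith

/-- A test for the interval `[l, l + Δ]`. -/
noncomputable def split (l Δ : ℝ) : Split := (exists_split l Δ).choose

theorem split_works {l Δ : ℝ} (hl : 0 ≤ l) (hΔ : 0 < Δ) (h : l + Δ ≤ Real.pi / 3) :
    (split l Δ).Works l Δ := (exists_split l Δ).choose_spec hl hΔ h

/-! ### The search for the angle of an outcome -/

section Tree

variable {d c M : ℕ} [NeZero d] (C : Counter c M) (i : Fin d) (reps : ℕ → ℕ) (Δ₀ : ℝ)
  (leaf : ℝ → Prog d 3 c)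

/-- The decision tree of depth `n` that shrinks an interval with left end `l` and length
`Δ₀ (3 / 2) ^ n` to one of length `Δ₀`, with `reps n` coin flips at its root.  The leaves run
`leaf l`, where `l` is the left end of the final interval. -/
noncomputable def tree : ℕ → ℝ → Prog d 3 c
  | 0, l => leaf l
  | n + 1, l =>
    .seq (flips C i (split l (Δ₀ * (3 / 2) ^ (n + 1))).k (reps (n + 1)))
      (.ite (C.cnt ⌈(split l (Δ₀ * (3 / 2) ^ (n + 1))).τ * reps (n + 1)⌉₊)
        (tree n (split l (Δ₀ * (3 / 2) ^ (n + 1))).l₁)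
        (tree n (split l (Δ₀ * (3 / 2) ^ (n + 1))).l₀))

variable {C i reps Δ₀ leaf}

theorem Split.Works.le_ceil {D : Split} {l : ℝ} {n : ℕ} (hΔ : 0 < Δ₀)
    (h : D.Works l (Δ₀ * (3 / 2) ^ n)) : D.k ≤ ⌈2 / Δ₀⌉₊ := by
  have h₁ : (1 : ℝ) ≤ (3 / 2) ^ n := one_le_pow₀ (by norm_num)
  have h₂ : D.k * Δ₀ ≤ D.k * (Δ₀ * (3 / 2) ^ n) := by
    gcongr; nlinarith
  have h₃ : (D.k : ℝ) ≤ 2 / Δ₀ := by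
    rw [le_div_iff₀ hΔ]; linarith [h.mul_le, Real.pi_le_four]
  exact_mod_cast h₃.trans (Nat.le_ceil _)

theorem Split.Works.child {D : Split} {l : ℝ} {n : ℕ}
    (h : D.Works l (Δ₀ * (3 / 2) ^ (n + 1))) (hl : 0 ≤ l)
    (h' : l + Δ₀ * (3 / 2) ^ (n + 1) ≤ Real.pi / 3) :
    (0 ≤ D.l₁ ∧ D.l₁ + Δ₀ * (3 / 2) ^ n ≤ Real.pi / 3) ∧
      0 ≤ D.l₀ ∧ D.l₀ + Δ₀ * (3 / 2) ^ n ≤ Real.pi / 3 := by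
  have h₁ := h.le₁
  have h₂ := h.le₁'
  have h₃ := h.le₀
  have h₄ := h.le₀'
  rw [pow_succ] at *
  refine ⟨⟨?_, ?_⟩, ?_, ?_⟩ <;> linarith

theorem size_tree_le (hΔ : 0 < Δ₀) {b : ℕ} (hb : ∀ l, (leaf l).size ≤ b) (n : ℕ) (l : ℝ)
    (hl : 0 ≤ l) (h : l + Δ₀ * (3 / 2) ^ n ≤ Real.pi / 3) (hreps : ∀ j ≤ n, reps j ≤ M) :
    let t := 2 * M + 7 + M * (2 * ((⌈2 / Δ₀⌉₊ + 1) * (30 + 2 * Nat.clog 2 d)) + 2 * M + 7)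
    (tree C i reps Δ₀ leaf n l).size + t ≤ 2 ^ n * (b + t) := by
  intro t
  induction n generalizing l with
  | zero => simpa [tree] using hb l
  | succ n ih =>
    have hD := split_works hl (show 0 < Δ₀ * (3 / 2) ^ (n + 1) by positivity) h
    obtain ⟨⟨h₁, h₂⟩, h₃, h₄⟩ := hD.child hl h
    have e₁ := ih _ h₁ h₂ fun j hj => hreps j (by omega)
    have e₀ := ih _ h₃ h₄ fun j hj => hreps j (by omega)
    have e := size_flips_le C i (hD.le_ceil hΔ) (hreps (n + 1) le_rfl)
    rw [pow_succ, mul_assoc, mul_comm 2, ← mul_assoc]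
    simp only [tree, Prog.size]
    omega

variable {H : Type*} [NormedAddCommGroup H] [InnerProductSpace ℂ H]
  {φ : H} (U : Joint H d ≃ₗᵢ[ℂ] Joint H d)

theorem roundSteps_mono {d k K : ℕ} (h : k ≤ K) : roundSteps d k ≤ roundSteps d K := by
  unfold roundSteps; gcongr

/-- The number of calls of the tests grows geometrically towards the leaves, so that their sum is
dominated by the last ones. -/
theorem tree_reliable (hφ : ‖φ‖ = 1) (hΔ : 0 < Δ₀) {S : Set (Fin c)} (hS : C.scratch ⊆ S) {B₀ : ℕ}
    (hleaf : ∀ l, Reliable φ U (leaf l) S 0 B₀) {κ L : ℝ} (hκ : 0 ≤ κ) (hL : 0 ≤ L) (n : ℕ)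
    (l : ℝ) (hl : 0 ≤ l) (h : l + Δ₀ * (3 / 2) ^ n ≤ Real.pi / 3) (hreps : ∀ j ≤ n, reps j ≤ M)
    (hreps' : ∀ j ≤ n, (reps j : ℝ) ≤ κ * (L + j)) :
    ∃ A B : ℕ, Reliable φ U (tree C i reps Δ₀ leaf n l) S A B ∧
      (A : ℝ) ≤ 20 * κ / Δ₀ * (2 * L + 6 - (2 / 3) ^ n * (2 * L + 2 * n + 6)) ∧
      B ≤ B₀ + n * (M + 4 + M * (2 * roundSteps d ⌈2 / Δ₀⌉₊ + M + 4)) := by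
  induction n generalizing l with
  | zero => exact ⟨0, B₀, hleaf l, by simp, by simp⟩
  | succ n ih =>
    have hD := split_works hl (show 0 < Δ₀ * (3 / 2) ^ (n + 1) by positivity) h
    obtain ⟨⟨h₁, h₂⟩, h₃, h₄⟩ := hD.child hl h
    obtain ⟨A₁, B₁, r₁, hA₁, hB₁⟩ := ih _ h₁ h₂ (fun j hj => hreps j (by omega))
      fun j hj => hreps' j (by omega)
    obtain ⟨A₀, B₂, r₀, hA₀, hB₀⟩ := ih _ h₃ h₄ (fun j hj => hreps j (by omega))
      fun j hj => hreps' j (by omega)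
    have hk := hD.le_ceil hΔ
    set D := split l (Δ₀ * (3 / 2) ^ (n + 1)) with hDdef
    have r := ((flips_reliable U hφ C i D.k (reps (n + 1))).mono hS le_rfl le_rfl).seq
      (Reliable.ite (C.cnt ⌈D.τ * reps (n + 1)⌉₊)
        (r₁.mono subset_rfl (le_max_left A₁ A₀) (le_max_left B₁ B₂))
        (r₀.mono subset_rfl (le_max_right A₁ A₀) (le_max_right B₁ B₂)))
    refine ⟨_, _, r, ?_, ?_⟩
    · push_cast
      have hmax : max (A₁ : ℝ) A₀ ≤
          20 * κ / Δ₀ * (2 * L + 6 - (2 / 3) ^ n * (2 * L + 2 * n + 6)) := max_le hA₁ hA₀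
      have hk₁ : (1 : ℝ) ≤ D.k := by exact_mod_cast hD.one_le
      have hk₂ : (D.k : ℝ) ≤ Real.pi / 2 / Δ₀ * (2 / 3) ^ (n + 1) := by
        have h₅ := hD.mul_le
        rw [← mul_assoc] at h₅
        have h₆ : ((2 : ℝ) / 3) ^ (n + 1) = 1 / (3 / 2) ^ (n + 1) := by
          rw [← one_div_pow]; norm_num
        rw [h₆, mul_one_div, le_div_iff₀ (by positivity), le_div_iff₀ hΔ]
        linarith
      have hr := hreps' (n + 1) le_rfl
      push_cast at hr
      have hL' : 0 ≤ κ * (L + (n + 1)) := by positivity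
      have h₇ : (reps (n + 1) : ℝ) * (2 * (4 * D.k + 2)) ≤
          κ * (L + (n + 1)) * (20 / Δ₀ * (2 / 3) ^ (n + 1)) := by
        refine mul_le_mul hr ?_ (by positivity) hL'
        have h₈ : Real.pi / 2 / Δ₀ * (2 / 3) ^ (n + 1) ≤ (3.15 / 2) / Δ₀ * (2 / 3) ^ (n + 1) := by
          gcongr; exact Real.pi_lt_d2.le
        have h₉ : 12 * ((3.15 / 2) / Δ₀ * (2 / 3) ^ (n + 1)) ≤
            20 / Δ₀ * (2 / 3) ^ (n + 1) := by
          have : 0 ≤ 1 / Δ₀ * (2 / 3) ^ (n + 1) := by positivity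
          calc _ = 18.9 * (1 / Δ₀ * (2 / 3) ^ (n + 1)) := by ring
            _ ≤ 20 * (1 / Δ₀ * (2 / 3) ^ (n + 1)) := by gcongr; norm_num
            _ = _ := by ring
        linarith
      refine (add_le_add h₇ hmax).trans (le_of_eq ?_)
      ring
    · have h₅ : reps (n + 1) * (2 * roundSteps d D.k + M + 4) ≤
          M * (2 * roundSteps d ⌈2 / Δ₀⌉₊ + M + 4) :=
        Nat.mul_le_mul (hreps _ le_rfl) (by have := roundSteps_mono (d := d) hk; omega)
      have h₆ := max_le hB₁ hB₀
      rw [add_mul, one_mul]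
      omega

/-- The error probability is halved at each step from the leaves to the root, so that the errors
along a path add up to at most `a`. -/
theorem tree_error (hφ : ‖φ‖ = 1) (hΔ : 0 < Δ₀) {S : Set (Fin c)} (hS : C.scratch ⊆ S) {B₀ : ℕ}
    (hleaf : ∀ l, Reliable φ U (leaf l) S 0 B₀) {G : (Fin c → Bool) → ℝ} (hG' : ∀ μ, G μ ≤ 1)
    (hGleaf : ∀ l, l ≤ angle φ U i → angle φ U i ≤ l + Δ₀ → ∀ n s, Clean φ s →
      wsum (exec φ U n (leaf l) s) (fun t => G t.mem) ≤ 0)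
    {a : ℝ} (ha : 0 ≤ a) (N : ℕ)
    (hreps : ∀ j ≤ N, reps j ≤ M)
    (hreps' : ∀ j ≤ N, Real.exp (-((1 / 768) ^ 2 / 4 * reps j)) ≤ a * (1 / 2) ^ j)
    (l : ℝ) (hl : 0 ≤ l) (h : l + Δ₀ * (3 / 2) ^ N ≤ Real.pi / 3) (hx : l ≤ angle φ U i)
    (hx' : angle φ U i ≤ l + Δ₀ * (3 / 2) ^ N) (n : ℕ) (s : Branch H d 3 c) (hs : Clean φ s) :
    wsum (exec φ U n (tree C i reps Δ₀ leaf N l) s) (fun t => G t.mem) ≤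
      s.weight * (a * (1 - (1 / 2) ^ N)) := by
  induction N generalizing l s with
  | zero =>
    simpa [tree] using hGleaf l hx (by simpa using hx') n s hs
  | succ N ih =>
    have hD := split_works hl (show 0 < Δ₀ * (3 / 2) ^ (N + 1) by positivity) h
    obtain ⟨⟨h₁, h₂⟩, h₃, h₄⟩ := hD.child hl h
    have hr := hreps' (N + 1) le_rfl
    have rel : ∀ l, 0 ≤ l → l + Δ₀ * (3 / 2) ^ N ≤ Real.pi / 3 → ∀ s, Clean φ s →
        wsum (exec φ U n (tree C i reps Δ₀ leaf N l) s) (fun t => G t.mem) ≤ s.weight := by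
      intro l hl h s hs
      -- only the conservation of probability is used, so that any cost bound will do
      obtain ⟨A, B, r, -, -⟩ := tree_reliable (reps := reps) (i := i) U hφ hΔ hS hleaf
        (κ := ∑ j ∈ Finset.range (N + 1), (reps j : ℝ)) (L := 1)
        (Finset.sum_nonneg fun _ _ => Nat.cast_nonneg _) zero_le_one N l hl h
        (fun j hj => hreps j (by omega)) fun j hj => by
          have : (reps j : ℝ) ≤ ∑ j ∈ Finset.range (N + 1), (reps j : ℝ) :=
            Finset.single_le_sum (f := fun j => (reps j : ℝ)) (fun _ _ => Nat.cast_nonneg _)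
              (Finset.mem_range.2 (by omega))
          nlinarith [Nat.cast_nonneg (α := ℝ) j, Nat.cast_nonneg (α := ℝ) (reps j)]
      exact (wsum_mono fun t _ => hG' t.mem).trans (r.mass n hs)
    have good := fun l hl h hx hx' s hs => ih (fun j hj => hreps j (by omega))
      (fun j hj => hreps' j (by omega)) l hl h hx hx' s hs
    set D := split l (Δ₀ * (3 / 2) ^ (N + 1)) with hDdef
    set e := a * (1 - (1 / 2) ^ N) with he
    have he0 : 0 ≤ e := mul_nonneg ha (sub_nonneg.2 (pow_le_one₀ (by norm_num) (by norm_num)))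
    have hrel := flips_reliable U hφ C i D.k (reps (N + 1))
    have hbit := hreps (N + 1) le_rfl
    -- it suffices to bound the probability that the test takes a wrong turn
    have main : ∀ W : Branch H d 3 c → ℝ, (∀ t, 0 ≤ W t) →
        (∀ t, t.mem (C.cnt ⌈D.τ * reps (N + 1)⌉₊) = true →
          (D.l₁ ≤ angle φ U i ∧ angle φ U i ≤ D.l₁ + Δ₀ * (3 / 2) ^ N) ∨ 1 ≤ W t) →
        (∀ t, t.mem (C.cnt ⌈D.τ * reps (N + 1)⌉₊) = false →
          (D.l₀ ≤ angle φ U i ∧ angle φ U i ≤ D.l₀ + Δ₀ * (3 / 2) ^ N) ∨ 1 ≤ W t) →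
        wsum (exec φ U n (flips C i D.k (reps (N + 1))) s) W ≤
          s.weight * Real.exp (-((1 / 768) ^ 2 / 4 * reps (N + 1))) →
        wsum (exec φ U n (tree C i reps Δ₀ leaf (N + 1) l) s) (fun t => G t.mem) ≤
          s.weight * (a * (1 - (1 / 2) ^ (N + 1))) := by
      intro W hW hW₁ hW₀ hWs
      refine (wsum_flatMap_le (F := fun t => e + W t) fun t ht => ?_).trans ?_
      · have hc := hrel.clean n s hs t ht
        have hw := t.weight_nonneg
        have hmix : ∀ l, 0 ≤ l → l + Δ₀ * (3 / 2) ^ N ≤ Real.pi / 3 →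
            ((l ≤ angle φ U i ∧ angle φ U i ≤ l + Δ₀ * (3 / 2) ^ N) ∨ 1 ≤ W t) →
            wsum (exec φ U n (tree C i reps Δ₀ leaf N l) (t.spend 1)) (fun t => G t.mem) ≤
              t.weight * (e + W t) := by
          intro l hl h hor
          rcases hor with hor | hor
          · refine (good l hl h hor.1 hor.2 (t.spend 1) hc).trans ?_
            exact mul_le_mul_of_nonneg_left (by linarith [hW t]) hw
          · refine (rel l hl h (t.spend 1) hc).trans ?_
            show t.weight ≤ _
            nlinarith
        simp only [exec, ← hDdef]
        split_ifs with hb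
        · exact hmix _ h₁ h₂ (hW₁ t hb)
        · exact hmix _ h₃ h₄ (hW₀ t (by simpa using hb))
      · rw [wsum_add, wsum_const]
        have hm := mul_le_mul_of_nonneg_left (hrel.mass n hs) he0
        have hr' := mul_le_mul_of_nonneg_left hr s.weight_nonneg
        refine (add_le_add hm (hWs.trans hr')).trans (le_of_eq ?_)
        rw [he]; ring
    have e₃ : ∀ y, y + 2 * (Δ₀ * (3 / 2) ^ (N + 1)) / 3 = y + Δ₀ * (3 / 2) ^ N := by
      intro y; rw [pow_succ]; ring
    have hlow := hD.low _ hx hx'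
    have hhigh := hD.high _ hx hx'
    rw [e₃] at hlow hhigh
    by_cases c₁ : D.l₁ ≤ angle φ U i ∧ angle φ U i ≤ D.l₁ + Δ₀ * (3 / 2) ^ N
    · by_cases c₀ : D.l₀ ≤ angle φ U i ∧ angle φ U i ≤ D.l₀ + Δ₀ * (3 / 2) ^ N
      · refine main (fun _ => 0) (fun _ => le_rfl) (fun _ _ => Or.inl c₁) (fun _ _ => Or.inl c₀) ?_
        rw [wsum_const, zero_mul]
        have := s.weight_nonneg
        positivity
      · refine main (fun t => if t.mem (C.cnt ⌈D.τ * reps (N + 1)⌉₊) then 0 else 1)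
          (fun t => by split_ifs <;> norm_num) (fun _ _ => Or.inl c₁)
          (fun t ht => Or.inr (by simp [ht])) ?_
        refine flips_high U hφ C i hbit n s hs (by norm_num) (by norm_num) hD.τ_le
          (hhigh fun h0 => ?_)
        by_contra! h1
        exact c₀ ⟨h0, h1⟩
    · have hlow' := hlow fun h0 => by
        by_contra! h1
        exact c₁ ⟨h0, h1⟩
      have c₀ : D.l₀ ≤ angle φ U i ∧ angle φ U i ≤ D.l₀ + Δ₀ * (3 / 2) ^ N := by
        by_contra c₀
        have := hhigh fun h0 => by
          by_contra! h1
          exact c₀ ⟨h0, h1⟩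
        linarith
      refine main (fun t => if t.mem (C.cnt ⌈D.τ * reps (N + 1)⌉₊) then 1 else 0)
        (fun t => by split_ifs <;> norm_num) (fun t ht => Or.inr (by simp [ht]))
        (fun _ _ => Or.inl c₀) ?_
      exact flips_low U hφ C i hbit n s hs (by norm_num) (by norm_num) hD.τ_le hlow'

end Tree

/-! ### The estimates -/

/-- The number with the binary digits `b` after the point. -/
noncomputable def binary {D : ℕ} (b : Fin D → Bool) : ℝ :=
  ∑ k : Fin D, if b k then ((2 : ℝ)⁻¹) ^ (k.val + 1) else 0

theorem exists_digits (D : ℕ) (v : ℝ) :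
    ∃ b : Fin D → Bool, 0 ≤ v → v ≤ 1 → |binary b - v| ≤ (2⁻¹ : ℝ) ^ D := by
  by_cases hv : 0 ≤ v ∧ v ≤ 1
  swap
  · exact ⟨fun _ => false, fun h₁ h₂ => absurd ⟨h₁, h₂⟩ hv⟩
  suffices ∃ b : Fin D → Bool, |binary b - v| ≤ (2⁻¹ : ℝ) ^ D from
    this.imp fun b hb _ _ => hb
  obtain ⟨h₀, h₁⟩ := hv
  induction D generalizing v with
  | zero => exact ⟨fun _ => false, by simp [binary, abs_le]; constructor <;> linarith⟩
  | succ D ih =>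
    have key : ∀ (b₀ : Bool) (b : Fin D → Bool),
        binary (Fin.cons b₀ b : Fin (D + 1) → Bool) = (if b₀ then 2⁻¹ else 0) + 2⁻¹ * binary b := by
      intro b₀ b
      simp only [binary, Fin.sum_univ_succ, Fin.cons_zero, Fin.cons_succ, Fin.val_zero,
        Fin.val_succ, Finset.mul_sum]
      congr 1
      · simp
      · refine Finset.sum_congr rfl fun k _ => ?_
        split_ifs
        · rw [pow_succ']
        · simp
    rcases le_total v (1 / 2) with h | h
    · obtain ⟨b, hb⟩ := ih (2 * v) (by linarith) (by linarith)
      refine ⟨Fin.cons false b, ?_⟩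
      rw [key, pow_succ']
      rw [show (if false = true then (2⁻¹ : ℝ) else 0) + 2⁻¹ * binary b - v =
        2⁻¹ * (binary b - 2 * v) by simp; ring, abs_mul, abs_of_pos (by norm_num : (0 : ℝ) < 2⁻¹)]
      gcongr
    · obtain ⟨b, hb⟩ := ih (2 * v - 1) (by linarith) (by linarith)
      refine ⟨Fin.cons true b, ?_⟩
      rw [key, pow_succ']
      rw [show (if true = true then (2⁻¹ : ℝ) else 0) + 2⁻¹ * binary b - v =
        2⁻¹ * (binary b - (2 * v - 1)) by simp; ring, abs_mul,
        abs_of_pos (by norm_num : (0 : ℝ) < 2⁻¹)]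
      gcongr

/-- The first `D` binary digits of a number in the unit interval. -/
noncomputable def digitsOf (D : ℕ) (v : ℝ) : Fin D → Bool := (exists_digits D v).choose

theorem abs_binary_digitsOf_sub_le (D : ℕ) {v : ℝ} (h₀ : 0 ≤ v) (h₁ : v ≤ 1) :
    |binary (digitsOf D v) - v| ≤ (2⁻¹ : ℝ) ^ D := (exists_digits D v).choose_spec h₀ h₁

section Layout

variable (d D M : ℕ)

/-- The classical bits of the algorithm: the flag, the counter and the digits of the estimates. -/
abbrev Bits : Type := Option (Fin (M + 1) ⊕ (Fin d × Fin D))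

/-- The numbering of the bits. -/
noncomputable def bit : Bits d D M ≃ Fin (Fintype.card (Bits d D M)) := Fintype.equivFin _

theorem card_bits : Fintype.card (Bits d D M) = M + 1 + d * D + 1 := by simp [Bits]

/-- The counter of the algorithm. -/
noncomputable def counter : Counter (Fintype.card (Bits d D M)) M where
  flag := bit d D M none
  cnt t := if h : t < M + 1 then bit d D M (some (.inl ⟨t, h⟩)) else bit d D M none
  inj a ha b hb h := by
    rw [dif_pos (by omega), dif_pos (by omega)] at h
    simpa using h
  flag_ne a ha h := by
    rw [dif_pos (by omega)] at h
    simp at h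

variable {d}

/-- The bit for digit `k` of estimate `i`. -/
noncomputable def outBit (i : Fin d) (k : Fin D) : Fin (Fintype.card (Bits d D M)) :=
  bit d D M (some (.inr (i, k)))

variable {D M}

theorem outBit_not_mem_scratch (i : Fin d) (k : Fin D) :
    outBit D M i k ∉ (counter d D M).scratch := by
  rintro (h | ⟨t, ht, h⟩)
  · simp [counter, outBit] at h
  · have ht' : t ≤ M := ht
    simp [counter, outBit, ht'] at h

theorem outBit_injective {i j : Fin d} {k l : Fin D} (h : outBit D M i k = outBit D M j l) :
    i = j ∧ k = l := by simpa [outBit] using h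

/-- Write the number `v` to the digits of estimate `i`. -/
noncomputable def writeOut (D M : ℕ) (i : Fin d) (v : ℝ) :
    Prog d 3 (Fintype.card (Bits d D M)) :=
  writes (List.ofFn fun k => (outBit D M i k, digitsOf D v k))

theorem size_writeOut_le (i : Fin d) (v : ℝ) : (writeOut D M i v).size ≤ 2 * D + 1 := by
  have := size_writes (d := d) (w := 3) (List.ofFn fun k => (outBit D M i k, digitsOf D v k))
  simpa [writeOut] using this

variable {H : Type*} [NormedAddCommGroup H] [InnerProductSpace ℂ H] [NeZero d]

theorem writeOut_reliable (φ : H) (U : Joint H d ≃ₗᵢ[ℂ] Joint H d) (i : Fin d) (v : ℝ) :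
    Reliable φ U (writeOut D M i v) (Set.range (outBit D M i)) 0 (D + 1) := by
  have := writes_reliable φ U (List.ofFn fun k => (outBit D M i k, digitsOf D v k))
    (S := Set.range (outBit D M i)) (by simp)
  simpa [writeOut] using this

/-- The indicator of the event that estimate `i`, read off the memory, is not within `δ` of `q`. -/
noncomputable def missed (q δ : ℝ) (i : Fin d) (μ : Fin (Fintype.card (Bits d D M)) → Bool) : ℝ :=
  if |binary (fun k => μ (outBit D M i k)) - q| < δ then 0 else 1

omit [NeZero d] in
theorem missed_nonneg (q δ : ℝ) (i : Fin d) (μ : Fin (Fintype.card (Bits d D M)) → Bool) :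
    0 ≤ missed q δ i μ := by unfold missed; split_ifs <;> norm_num

omit [NeZero d] in
theorem missed_le_one (q δ : ℝ) (i : Fin d) (μ : Fin (Fintype.card (Bits d D M)) → Bool) :
    missed q δ i μ ≤ 1 := by unfold missed; split_ifs <;> norm_num

omit [NeZero d] in
theorem writeOut_not_missed (φ : H) (U : Joint H d ≃ₗᵢ[ℂ] Joint H d) (i : Fin d) {v q δ : ℝ}
    (h : |binary (digitsOf D v) - q| < δ) (n : ℕ)
    (s : Branch H d 3 (Fintype.card (Bits d D M))) :
    wsum (exec φ U n (writeOut D M i v) s) (fun t => missed q δ i t.mem) = 0 := by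
  obtain ⟨μ, h₁, -, h₂⟩ := exec_writes φ U n
    (List.ofFn fun k => (outBit D M i k, digitsOf D v k)) s
  have h₃ : (fun k => μ (outBit D M i k)) = digitsOf D v := by
    funext k
    refine h₂ ?_ (outBit D M i k, digitsOf D v k) (List.mem_ofFn.2 ⟨k, rfl⟩)
    rw [List.map_ofFn, List.nodup_ofFn]
    intro k l h
    exact (outBit_injective h).2
  rw [writeOut, h₁, wsum_cons, wsum_nil, missed, h₃, if_pos h]
  simp

end Layout

section Assembly

variable {d D M : ℕ} [NeZero d]

/-- The algorithm that runs the program `T i` for each `i` in turn. -/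
noncomputable def assemble (D M : ℕ) (T : Fin d → Prog d 3 (Fintype.card (Bits d D M))) :
    Algorithm d where
  qubits := 3
  bits := Fintype.card (Bits d D M)
  digits := D
  prog := seqs ((List.finRange d).map T)
  out := outBit D M

omit [NeZero d] in
theorem size_assemble_le (T : Fin d → Prog d 3 (Fintype.card (Bits d D M))) {b : ℕ}
    (hT : ∀ i, (T i).size ≤ b) :
    (assemble D M T).size ≤ M + 2 * (d * D) + d * (b + 1) + 6 := by
  have h := size_seqs_le (l := (List.finRange d).map T) (b := b) (by simpa using hT)
  simp only [List.length_map, List.length_finRange] at h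
  simp only [Algorithm.size, assemble, card_bits]
  omega

variable {H : Type*} [NormedAddCommGroup H] [InnerProductSpace ℂ H]
  {φ : H} {U : Joint H d ≃ₗᵢ[ℂ] Joint H d}

/-- The bits that the program for estimate `i` may write. -/
def ownBits (D M : ℕ) (i : Fin d) : Set (Fin (Fintype.card (Bits d D M))) :=
  (counter d D M).scratch ∪ Set.range (outBit D M i)

theorem seqs_missed_le {T : Fin d → Prog d 3 (Fintype.card (Bits d D M))} {A B : ℕ}
    (hT : ∀ i, Reliable φ U (T i) (ownBits D M i) A B) {q : Fin d → ℝ} {δ e : ℝ} (he : 0 ≤ e)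
    (hm : ∀ i n s, Clean φ s →
      wsum (exec φ U n (T i) s) (fun t => missed (q i) δ i t.mem) ≤ s.weight * e)
    {l : List (Fin d)} (hl : l.Nodup) {i : Fin d} (hi : i ∈ l) (n : ℕ)
    (s : Branch H d 3 (Fintype.card (Bits d D M))) (hs : Clean φ s) :
    wsum (exec φ U n (seqs (l.map T)) s) (fun t => missed (q i) δ i t.mem) ≤ s.weight * e := by
  induction l generalizing s with
  | nil => simp at hi
  | cons j l ih =>
    rw [List.nodup_cons] at hl
    have hc := (hT j).clean n s hs
    rcases List.mem_cons.1 hi with rfl | hi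
    · -- the later programs do not touch the digits of estimate `i`
      have hr : Reliable φ U (seqs (l.map T)) (Set.range (outBit D M i))ᶜ _ _ :=
        Reliable.seqs (A := A) (B := B) fun p hp => by
          obtain ⟨j, hj, rfl⟩ := List.mem_map.1 hp
          refine (hT j).mono ?_ le_rfl le_rfl
          rintro b (hb | ⟨k, rfl⟩) ⟨k', hk'⟩
          · exact outBit_not_mem_scratch i k' (hk' ▸ hb)
          · exact hl.1 ((outBit_injective hk').1 ▸ hj)
      refine (wsum_flatMap_le (F := fun t => missed (q i) δ i t.mem) fun t ht => ?_).trans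
        (hm i n s hs)
      refine hr.frame (missed (q i) δ i) (missed_nonneg _ _ _) (fun μ ν h => ?_) n t (hc t ht)
      have : (fun k => μ (outBit D M i k)) = fun k => ν (outBit D M i k) :=
        funext fun k => h _ (by simp)
      simp only [missed, this]
    · refine (wsum_flatMap_le (F := fun _ => e) fun t ht => ih hl.2 hi t (hc t ht)).trans ?_
      rw [wsum_const, mul_comm]
      exact mul_le_mul_of_nonneg_right ((hT j).mass n hs) he

omit [NeZero d] [InnerProductSpace ℂ H] in
theorem wsum_eq_sum_ofReal {w c : ℕ} (l : List (Branch H d w c)) {f : Branch H d w c → ENNReal}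
    {g : Branch H d w c → ℝ} (hg : ∀ t ∈ l, 0 ≤ g t) (h : ∀ t ∈ l, f t = ENNReal.ofReal (g t)) :
    (l.map fun t => ENNReal.ofReal t.weight * f t).sum = ENNReal.ofReal (wsum l g) := by
  induction l with
  | nil => simp
  | cons a l ih =>
    rw [List.map_cons, List.sum_cons, wsum_cons, ih (fun t ht => hg t (by simp [ht]))
      (fun t ht => h t (by simp [ht])), h a (by simp), ← ENNReal.ofReal_mul a.weight_nonneg,
      ENNReal.ofReal_add (mul_nonneg a.weight_nonneg (hg a (by simp)))]
    exact wsum_nonneg fun t ht => hg t (by simp [ht])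

theorem ofReal_le_of_forall_lt_one {e : ℝ} {X : ENNReal}
    (h : ∀ η : ℝ, 0 ≤ η → η < 1 → ENNReal.ofReal (η - e) ≤ X) : ENNReal.ofReal (1 - e) ≤ X := by
  rcases eq_or_ne X ⊤ with rfl | hX
  · exact le_top
  rw [ENNReal.ofReal_le_iff_le_toReal hX]
  have : ∀ η : ℝ, 0 ≤ η → η < 1 → η - e ≤ X.toReal := fun η h₀ h₁ =>
    (ENNReal.ofReal_le_iff_le_toReal hX).1 (h η h₀ h₁)
  by_contra! hlt
  have h₁ := this (max 0 ((X.toReal + e + 1) / 2)) (le_max_left _ _)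
    (max_lt one_pos (by linarith))
  have h₂ := le_max_right 0 ((X.toReal + e + 1) / 2)
  linarith

/-- The initial configuration. -/
noncomputable def initial (φ : H) (c : ℕ) : Branch H d 3 c := ⟨fun _ => false, idle φ, 0, 0⟩

theorem expect_assemble (T : Fin d → Prog d 3 (Fintype.card (Bits d D M)))
    (f : Branch H d 3 (Fintype.card (Bits d D M)) → ENNReal) :
    (assemble D M T).expect φ U f = ⨆ n : ℕ,
      ((exec φ U n (seqs ((List.finRange d).map T)) (initial φ _)).map
        fun s => ENNReal.ofReal s.weight * f s).sum := rfl

theorem clean_initial (c : ℕ) : Clean φ (initial (d := d) φ c) := ⟨1, (one_smul ℂ _).symm⟩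

theorem weight_initial (hφ : ‖φ‖ = 1) (c : ℕ) : (initial (d := d) φ c).weight = 1 := by
  rw [weight_clean (i := 0) (LinearIsometryEquiv.refl ℂ (Joint H d)) hφ (initial φ c) 1
    (by rw [← idle_eq_plane, one_smul]; rfl)]
  simp

theorem Clean.undamaged {c : ℕ} {s : Branch H d 3 c} (hs : Clean φ s) : Undamaged φ s.vec := by
  obtain ⟨z, hz⟩ := hs
  refine ⟨fun x i => if x = (fun _ => false) ∧ i = 0 then z else 0, fun x i => ?_⟩
  rw [hz]
  by_cases hx : x = fun _ => false
  · subst hx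
    by_cases hi : i = 0
    · subst hi; simp [idle, withFirst]
    · simp [idle, withFirst, hi]
  · simp [idle, hx]

theorem assemble_spec (hφ : ‖φ‖ = 1) {T : Fin d → Prog d 3 (Fintype.card (Bits d D M))} {A B : ℕ}
    (hT : ∀ i, Reliable φ U (T i) (ownBits D M i) A B) {q : Fin d → ℝ} {δ e : ℝ} (he : 0 ≤ e)
    (hm : ∀ i n s, Clean φ s →
      wsum (exec φ U n (T i) s) (fun t => missed (q i) δ i t.mem) ≤ s.weight * e) :
    (assemble D M T).prob φ U {b | Undamaged φ b.vec} = 1 ∧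
    ENNReal.ofReal (1 - d * e) ≤ (assemble D M T).prob φ U
      {b | ∀ i, |(assemble D M T).estimate b.mem i - q i| < δ} ∧
    (assemble D M T).expect φ U (fun b => (b.calls : ENNReal)) ≤ ENNReal.ofReal (d * A : ℕ) ∧
    (assemble D M T).expect φ U (fun b => (b.steps : ENNReal)) ≤
      ENNReal.ofReal (d * B + 1 : ℕ) := by
  classical
  have hs := clean_initial (φ := φ) (d := d) (Fintype.card (Bits d D M))
  have hw := weight_initial (d := d) hφ (Fintype.card (Bits d D M))
  have hr : Reliable φ U (seqs ((List.finRange d).map T)) Set.univ (d * A) (d * B + 1) := by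
    have := Reliable.seqs (l := (List.finRange d).map T) (φ := φ) (U := U) (S := Set.univ)
      (A := A) (B := B) fun p hp => by
        obtain ⟨j, hj, rfl⟩ := List.mem_map.1 hp
        exact (hT j).mono (Set.subset_univ _) le_rfl le_rfl
    simpa using this
  have hcost := fun α β hα hβ n => hr.cost_le α β hα hβ n _ hs
  have hc0 : ∀ α β : ℝ, cost α β (initial (d := d) φ (Fintype.card (Bits d D M))) = 0 := by
    intro α β; simp [cost, initial]
  simp only [hw, hc0] at hcost
  have hund : ∀ n, ((exec φ U n (seqs ((List.finRange d).map T)) (initial φ _)).map fun s =>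
      ENNReal.ofReal s.weight *
        Set.indicator {b : Branch H d 3 (Fintype.card (Bits d D M)) | Undamaged φ b.vec} 1 s).sum =
      ENNReal.ofReal (wsum (exec φ U n (seqs ((List.finRange d).map T)) (initial φ _))
        fun _ => 1) := fun n =>
    wsum_eq_sum_ofReal _ (fun _ _ => zero_le_one) fun t ht => by
      simp [(hr.clean n _ hs t ht).undamaged]
  refine ⟨le_antisymm ?_ ?_, ?_, ?_, ?_⟩
  · refine (expect_assemble ..).trans_le ?_
    refine iSup_le fun n => ?_
    refine (hund n).trans_le ?_
    have := hr.mass n hs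
    rw [hw] at this
    exact ENNReal.ofReal_le_one.2 this
  · have := ofReal_le_of_forall_lt_one (e := 0)
      (X := (assemble D M T).prob φ U {b | Undamaged φ b.vec}) fun η h₀ h₁ => by
        obtain ⟨N, hN⟩ := hr.halts η h₀ h₁
        refine le_trans ?_ (expect_assemble ..).ge
        refine le_trans ?_ (le_iSup _ N)
        refine le_trans ?_ (hund N).ge
        have := hN N le_rfl _ hs
        rw [hw] at this
        exact ENNReal.ofReal_le_ofReal (by linarith)
    simpa using this
  · refine ofReal_le_of_forall_lt_one fun η h₀ h₁ => ?_
    obtain ⟨N, hN⟩ := hr.halts η h₀ h₁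
    refine le_trans ?_ (expect_assemble ..).ge
    refine le_trans ?_ (le_iSup _ N)
    set l := exec φ U N (seqs ((List.finRange d).map T)) (initial φ _)
    refine le_trans ?_ (wsum_eq_sum_ofReal l (g := fun t => if
      ∀ i, |(assemble D M T).estimate t.mem i - q i| < δ then 1 else 0)
      (fun t _ => by split_ifs <;> norm_num) fun t ht => ?_).ge
    swap
    · by_cases h : ∀ i, |(assemble D M T).estimate t.mem i - q i| < δ
      · exact (Set.indicator_of_mem (s := {b : Branch H d 3 (Fintype.card (Bits d D M)) |
          ∀ i, |(assemble D M T).estimate b.mem i - q i| < δ}) h _).trans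
          (by rw [if_pos h, ENNReal.ofReal_one]; rfl)
      · exact (Set.indicator_of_notMem (s := {b : Branch H d 3 (Fintype.card (Bits d D M)) |
          ∀ i, |(assemble D M T).estimate b.mem i - q i| < δ}) h _).trans (by simp [h])
    refine ENNReal.ofReal_le_ofReal ?_
    have h₂ := hN N le_rfl _ hs
    rw [hw, mul_one] at h₂
    have h₃ : ∀ l : List (Branch H d 3 (Fintype.card (Bits d D M))),
        wsum l (fun t => ∑ i, missed (q i) δ i t.mem) =
        ∑ i, wsum l fun t => missed (q i) δ i t.mem := by
      intro l
      induction l with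
      | nil => simp
      | cons a l ih => simp only [wsum_cons, ih, Finset.mul_sum, Finset.sum_add_distrib]
    have h₄ : wsum l (fun t => ∑ i, missed (q i) δ i t.mem) ≤ d * e := by
      rw [h₃]
      refine (Finset.sum_le_sum fun i _ => seqs_missed_le hT he hm (List.nodup_finRange d)
        (List.mem_finRange i) N _ hs).trans ?_
      rw [hw]; simp
    have h₅ : wsum l (fun _ => 1) ≤ wsum l (fun t =>
        (if ∀ i, |(assemble D M T).estimate t.mem i - q i| < δ then 1 else 0) +
          ∑ i, missed (q i) δ i t.mem) := by
      refine wsum_mono fun t _ => ?_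
      have hnn := fun i => missed_nonneg (q i) δ i t.mem
      split_ifs with h
      · linarith [Finset.sum_nonneg fun i (_ : i ∈ Finset.univ) => hnn i]
      · push Not at h
        obtain ⟨i, hi⟩ := h
        have h₆ : missed (q i) δ i t.mem = 1 := if_neg (not_lt.2 hi)
        have := Finset.single_le_sum (fun i _ => hnn i) (Finset.mem_univ i)
        linarith
    rw [wsum_add] at h₅
    linarith
  · refine (expect_assemble ..).trans_le (iSup_le fun n => ?_)
    refine (wsum_eq_sum_ofReal _ (g := cost 1 0) (fun t _ => by simp [cost]) fun t ht => by
      simp [cost]).trans_le ?_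
    have := hcost 1 0 zero_le_one le_rfl n
    exact ENNReal.ofReal_le_ofReal (by linarith)
  · refine (expect_assemble ..).trans_le (iSup_le fun n => ?_)
    refine (wsum_eq_sum_ofReal _ (g := cost 0 1) (fun t _ => by simp [cost]) fun t ht => by
      simp [cost]).trans_le ?_
    have := hcost 0 1 le_rfl zero_le_one n
    exact ENNReal.ofReal_le_ofReal (by linarith)

end Assembly

/-! ### The choice of the parameters -/

/-- The number that measures the size of the instance, rounded up. -/
noncomputable def scale (d : ℕ) (δ ε : ℝ) : ℕ := ⌈d + 1 / δ + Real.log (1 / ε)⌉₊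

theorem log_inv_nonneg {ε : ℝ} (hε : 0 < ε) (hε' : ε < 1) : 0 ≤ Real.log (1 / ε) :=
  Real.log_nonneg (by rw [le_div_iff₀ hε]; linarith)

section Scale

variable {d : ℕ} [NeZero d] {δ ε : ℝ} (hδ : 0 < δ) (hε : 0 < ε) (hε' : ε < 1)

omit [NeZero d] in
theorem le_scale : (d : ℝ) + 1 / δ + Real.log (1 / ε) ≤ scale d δ ε := Nat.le_ceil _

include hδ hε hε'

omit [NeZero d] in
theorem natCast_le_scale : d ≤ scale d δ ε := by
  have h₁ := le_scale (d := d) (δ := δ) (ε := ε)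
  have h₂ := log_inv_nonneg hε hε'
  have h₃ : 0 < 1 / δ := by positivity
  exact_mod_cast (by linarith : (d : ℝ) ≤ scale d δ ε)

theorem one_le_scale : 1 ≤ scale d δ ε :=
  (Nat.one_le_iff_ne_zero.2 (NeZero.ne d)).trans (natCast_le_scale hδ hε hε')

omit [NeZero d] hδ in
theorem one_div_le_scale : 1 / δ ≤ scale d δ ε := by
  have h₁ := le_scale (d := d) (δ := δ) (ε := ε)
  have h₂ := log_inv_nonneg hε hε'
  have h₃ : (0 : ℝ) ≤ d := by positivity
  linarith

theorem log_le_scale : Real.log (d / ε) ≤ scale d δ ε := by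
  have h₁ := le_scale (d := d) (δ := δ) (ε := ε)
  have h₃ : 0 < 1 / δ := by positivity
  have hd : (0 : ℝ) < d := by exact_mod_cast Nat.pos_of_ne_zero (NeZero.ne d)
  have h₄ := Real.log_le_sub_one_of_pos hd
  rw [div_eq_mul_one_div, Real.log_mul hd.ne' (by positivity)]
  linarith

theorem scale_le : (scale d δ ε : ℝ) ≤ 2 * (d + 1 / δ + Real.log (1 / ε)) := by
  have h₂ := log_inv_nonneg hε hε'
  have h₃ : 0 < 1 / δ := by positivity
  have hd : (1 : ℝ) ≤ d := by exact_mod_cast Nat.pos_of_ne_zero (NeZero.ne d)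
  have := (Nat.ceil_lt_add_one (by positivity : (0 : ℝ) ≤ d + 1 / δ + Real.log (1 / ε))).le
  unfold scale
  linarith

end Scale

theorem inv_two_pow_ceil_lt {δ : ℝ} (hδ : 0 < δ) : (2⁻¹ : ℝ) ^ ⌈2 / δ⌉₊ < δ / 2 := by
  have h₁ : 2 / δ ≤ ⌈2 / δ⌉₊ := Nat.le_ceil _
  have h₂ : ((⌈2 / δ⌉₊ : ℕ) : ℝ) < 2 ^ ⌈2 / δ⌉₊ := by exact_mod_cast Nat.lt_two_pow_self
  rw [inv_pow, inv_lt_comm₀ (by positivity) (by positivity), inv_div]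
  linarith

/-- The widths `Δ₀ (3 / 2) ^ j` of the intervals of the search: from `π / 3`, where all angles
lie, to the required precision. -/
theorem exists_width {δ : ℝ} (hδ : 0 < δ) (hδ' : δ ≤ 1) :
    ∃ (J : ℕ) (Δ : ℝ), 0 < Δ ∧ δ / 3 ≤ Δ ∧ Δ < δ / 2 ∧ Δ * (3 / 2) ^ J = Real.pi / 3 ∧
      (2 : ℝ) ^ J ≤ 16 * (1 / δ) ^ 2 := by
  have hπ := Real.pi_gt_three
  have hπ' := Real.pi_le_four
  obtain ⟨n, h₁, h₂⟩ := exists_nat_pow_near (x := 2 * Real.pi / (3 * δ)) (y := (3 / 2 : ℝ))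
    (by rw [le_div_iff₀ (by positivity)]; linarith) (by norm_num)
  rw [le_div_iff₀ (by positivity)] at h₁
  rw [div_lt_iff₀ (by positivity)] at h₂
  have hp : (0 : ℝ) < (3 / 2) ^ (n + 1) := by positivity
  have h₃ : (3 / 2 : ℝ) ^ (n + 1) * δ ≤ Real.pi := by rw [pow_succ]; linarith
  refine ⟨n + 1, Real.pi / 3 / (3 / 2) ^ (n + 1), by positivity, ?_, ?_, ?_, ?_⟩
  · rw [le_div_iff₀ hp]; linarith
  · rw [div_lt_iff₀ hp]; linarith
  · field_simp
  · have h₄ : (3 / 2 : ℝ) ^ (n + 1) ≤ 4 * (1 / δ) := by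
      rw [mul_one_div, le_div_iff₀ hδ]; linarith
    calc (2 : ℝ) ^ (n + 1) ≤ (9 / 4) ^ (n + 1) := by gcongr; norm_num
      _ = ((3 / 2) ^ (n + 1)) ^ 2 := by rw [← pow_mul, mul_comm, pow_mul]; norm_num
      _ ≤ (4 * (1 / δ)) ^ 2 := by gcongr
      _ = 16 * (1 / δ) ^ 2 := by ring

/-- The number of coin flips at a node from which a path of length `j` leads to the leaves.  The
factor `2359296 = 4 * 768 ^ 2` cancels the one in the exponent of Chernoff's bound. -/
noncomputable def repsOf (L : ℝ) (j : ℕ) : ℕ := ⌈2359296 * (L + j)⌉₊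

theorem repsOf_mono (L : ℝ) : Monotone (repsOf L) := fun i j h => by
  unfold repsOf
  gcongr

theorem repsOf_le {L : ℝ} (hL : 1 / 2 ≤ L) (j : ℕ) : (repsOf L j : ℝ) ≤ 2359298 * (L + j) := by
  have h₀ : (0 : ℝ) ≤ j := by positivity
  have := (Nat.ceil_lt_add_one (by positivity : (0 : ℝ) ≤ 2359296 * (L + j))).le
  unfold repsOf
  linarith

theorem exp_repsOf_le (L : ℝ) (j : ℕ) :
    Real.exp (-((1 / 768) ^ 2 / 4 * repsOf L j)) ≤ Real.exp (-L) * (1 / 2) ^ j := by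
  have h₁ : 2359296 * (L + j) ≤ repsOf L j := Nat.le_ceil _
  have h₂ : Real.exp (-1) ≤ 1 / 2 := by
    rw [Real.exp_neg, one_div]
    gcongr
    linarith [Real.add_one_le_exp 1]
  calc Real.exp (-((1 / 768) ^ 2 / 4 * repsOf L j)) ≤ Real.exp (-L + j * (-1)) := by
        gcongr
        norm_num
        linarith
    _ = Real.exp (-L) * Real.exp (-1) ^ j := by rw [Real.exp_add, Real.exp_nat_mul]
    _ ≤ Real.exp (-L) * (1 / 2) ^ j := by gcongr

section Leaves

/-- The value reported for an angle in the interval `[l, l + Δ]`: the value at the midpoint,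
moved into the unit interval. -/
noncomputable def valueAt (Δ l : ℝ) : ℝ := max 0 (min 1 (2 * (1 - Real.cos (l + Δ / 2))))

theorem valueAt_nonneg (Δ l : ℝ) : 0 ≤ valueAt Δ l := le_max_left _ _

theorem valueAt_le_one (Δ l : ℝ) : valueAt Δ l ≤ 1 := max_le zero_le_one (min_le_left _ _)

variable {d : ℕ} [NeZero d] {H : Type*} [NormedAddCommGroup H] [InnerProductSpace ℂ H] {φ : H}
  (U : Joint H d ≃ₗᵢ[ℂ] Joint H d) (i : Fin d)

theorem abs_valueAt_sub_hitProb_le (hφ : ‖φ‖ = 1) {Δ l : ℝ} (h : l ≤ angle φ U i)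
    (h' : angle φ U i ≤ l + Δ) : |valueAt Δ l - hitProb φ U i| ≤ Δ := by
  have h₀ := hitProb_nonneg (φ := φ) U i
  have h₁ := hitProb_le_one U i hφ
  have hq : hitProb φ U i = 2 * (1 - Real.cos (angle φ U i)) := by
    rw [cos_angle U i hφ]; ring
  have hc := Real.abs_cos_sub_cos_le (angle φ U i) (l + Δ / 2)
  have h₂ : |angle φ U i - (l + Δ / 2)| ≤ Δ / 2 := abs_le.2 ⟨by linarith, by linarith⟩
  have h₃ := abs_le.1 (hc.trans h₂)
  have h₄ : hitProb φ U i - Δ ≤ valueAt Δ l :=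
    le_max_of_le_right (le_min (by linarith) (by linarith))
  have h₅ : valueAt Δ l ≤ hitProb φ U i + Δ :=
    max_le (by linarith) ((min_le_right _ _).trans (by linarith))
  exact abs_le.2 ⟨by linarith, by linarith⟩

theorem hitProb_eq_one (U : Joint H 1 ≃ₗᵢ[ℂ] Joint H 1) (hφ : ‖φ‖ = 1) (i : Fin 1) :
    hitProb φ U i = 1 := by
  have h : ‖U (withFirst φ)‖ ^ 2 = 1 := by
    rw [U.norm_map]
    simp [withFirst, hφ]
  rw [PiLp.norm_sq_eq_of_L2] at h
  rw [Subsingleton.elim i 0]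
  simpa [hitProb] using h

end Leaves

/-! ### Crude polynomial bounds for size and time -/

section Bounds

variable {Y M k c D J : ℕ} (hY : 1 ≤ Y) (hM : M ≤ 41000000 * Y ^ 2) (hk : k ≤ 6 * Y) (hc : c ≤ Y)
  (hD : D ≤ 3 * Y) (hJ : 2 ^ J ≤ 16 * Y ^ 2)

include hY hM hD

include hk hc hJ in
theorem tree_size_bound : 2 ^ J * (2 * D + 1 +
    (2 * M + 7 + M * (2 * ((k + 1) * (30 + 2 * c)) + 2 * M + 7))) ≤ 10 ^ 18 * Y ^ 6 := by
  have h₂ : 1 ≤ Y ^ 2 := Nat.one_le_pow _ _ hY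
  have h₄ : 1 ≤ Y ^ 4 := Nat.one_le_pow _ _ hY
  have h₂₄ := Nat.pow_le_pow_right hY (show 2 ≤ 4 by norm_num)
  have h₁₄ := Nat.le_self_pow (show 4 ≠ 0 by norm_num) Y
  have e₁ : (k + 1) * (30 + 2 * c) ≤ 224 * Y ^ 2 :=
    calc _ ≤ (7 * Y) * (32 * Y) := Nat.mul_le_mul (by omega) (by omega)
      _ = 224 * Y ^ 2 := by ring
  have e₂ : 2 * ((k + 1) * (30 + 2 * c)) + 2 * M + 7 ≤ 83000000 * Y ^ 2 := by omega
  have e₃ : M * (2 * ((k + 1) * (30 + 2 * c)) + 2 * M + 7) ≤ 3403000000000000 * Y ^ 4 :=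
    calc _ ≤ (41000000 * Y ^ 2) * (83000000 * Y ^ 2) := Nat.mul_le_mul hM e₂
      _ = 3403000000000000 * Y ^ 4 := by ring
  calc _ ≤ (16 * Y ^ 2) * (3500000000000000 * Y ^ 4) := Nat.mul_le_mul hJ (by omega)
    _ = 56000000000000000 * Y ^ 6 := by ring
    _ ≤ 10 ^ 18 * Y ^ 6 := Nat.mul_le_mul_right _ (by norm_num)

theorem size_bound {d : ℕ} (hd : d ≤ Y) :
    M + 2 * (d * D) + d * (10 ^ 18 * Y ^ 6 + 1) + 6 ≤ 10 ^ 19 * Y ^ 7 := by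
  have h₂ := Nat.pow_le_pow_right hY (show 2 ≤ 7 by norm_num)
  have h₁ := Nat.le_self_pow (show 7 ≠ 0 by norm_num) Y
  have h₇ : 1 ≤ Y ^ 7 := Nat.one_le_pow _ _ hY
  have e₁ : d * D ≤ 3 * Y ^ 2 :=
    calc _ ≤ Y * (3 * Y) := Nat.mul_le_mul hd hD
      _ = 3 * Y ^ 2 := by ring
  have e₂ : d * (10 ^ 18 * Y ^ 6 + 1) ≤ 10 ^ 18 * Y ^ 7 + Y :=
    calc _ ≤ Y * (10 ^ 18 * Y ^ 6 + 1) := Nat.mul_le_mul_right _ hd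
      _ = 10 ^ 18 * Y ^ 7 + Y := by ring
  omega

include hk hc hJ in
theorem steps_bound {d : ℕ} (hd : d ≤ Y) : d * (D + 1 + J * (M + 4 +
    M * (2 * (k * (11 + 2 * c) + 10 + c) + M + 4))) + 1 ≤ 10 ^ 19 * Y ^ 7 := by
  have h₂ : 1 ≤ Y ^ 2 := Nat.one_le_pow _ _ hY
  have h₇ : 1 ≤ Y ^ 7 := Nat.one_le_pow _ _ hY
  have h₁₂ := Nat.le_self_pow (show 2 ≠ 0 by norm_num) Y
  have h₂₄ := Nat.pow_le_pow_right hY (show 2 ≤ 4 by norm_num)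
  have h₁₆ := Nat.le_self_pow (show 6 ≠ 0 by norm_num) Y
  have hJ' : J ≤ 16 * Y ^ 2 := Nat.lt_two_pow_self.le.trans hJ
  have e₁ : k * (11 + 2 * c) ≤ 78 * Y ^ 2 :=
    calc _ ≤ (6 * Y) * (13 * Y) := Nat.mul_le_mul hk (by omega)
      _ = 78 * Y ^ 2 := by ring
  have e₃ : M * (2 * (k * (11 + 2 * c) + 10 + c) + M + 4) ≤ 1722000000000000 * Y ^ 4 :=
    calc _ ≤ (41000000 * Y ^ 2) * (42000000 * Y ^ 2) := Nat.mul_le_mul hM (by omega)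
      _ = 1722000000000000 * Y ^ 4 := by ring
  have e₄ : J * (M + 4 + M * (2 * (k * (11 + 2 * c) + 10 + c) + M + 4)) ≤
      10 ^ 18 * Y ^ 6 :=
    calc _ ≤ (16 * Y ^ 2) * (1800000000000000 * Y ^ 4) := Nat.mul_le_mul hJ' (by omega)
      _ = 28800000000000000 * Y ^ 6 := by ring
      _ ≤ 10 ^ 18 * Y ^ 6 := Nat.mul_le_mul_right _ (by norm_num)
  have e₅ : d * (D + 1 + J * (M + 4 + M * (2 * (k * (11 + 2 * c) + 10 + c) + M + 4))) ≤
      2000000000000000000 * Y ^ 7 :=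
    calc _ ≤ Y * (2000000000000000000 * Y ^ 6) := Nat.mul_le_mul hd (by omega)
      _ = 2000000000000000000 * Y ^ 7 := by ring
  omega

end Bounds

/-! ### One program for each outcome -/

section Programs

/-- The programs that estimate the probabilities of the single outcomes, with all bounds that enter
the theorem. -/
theorem exists_programs (d : ℕ) [NeZero d] {δ ε : ℝ} (hδ : 0 < δ) (hε : 0 < ε) (hε' : ε < 1) :
    ∃ (D M : ℕ) (T : Fin d → Prog d 3 (Fintype.card (Bits d D M))) (A B b : ℕ) (e : ℝ),
      0 ≤ e ∧ d * e ≤ ε ∧ ((d * A : ℕ) : ℝ) ≤ 2 * 10 ^ 9 * (d / δ * Real.log (d / ε)) ∧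
      M + 2 * (d * D) + d * (b + 1) + 6 ≤ 10 ^ 19 * scale d δ ε ^ 7 ∧
      d * B + 1 ≤ 10 ^ 19 * scale d δ ε ^ 7 ∧ (∀ i, (T i).size ≤ b) ∧
      ∀ (H : Type*) [NormedAddCommGroup H] [InnerProductSpace ℂ H] (φ : H)
        (U : Joint H d ≃ₗᵢ[ℂ] Joint H d), ‖φ‖ = 1 →
          (∀ i, Reliable φ U (T i) (ownBits D M i) A B) ∧
          ∀ i n s, Clean φ s →
            wsum (exec φ U n (T i) s) (fun t => missed (hitProb φ U i) δ i t.mem) ≤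
              s.weight * e := by
  have hY := one_le_scale (d := d) hδ hε hε'
  have hdY := natCast_le_scale (d := d) hδ hε hε'
  have hδY := one_div_le_scale (d := d) (δ := δ) hε hε'
  have hLY := log_le_scale (d := d) hδ hε hε'
  have hd : (1 : ℝ) ≤ d := by exact_mod_cast Nat.pos_of_ne_zero (NeZero.ne d)
  have hDδ := inv_two_pow_ceil_lt hδ
  have hD₁ : 1 ≤ ⌈2 / δ⌉₊ := Nat.one_le_iff_ne_zero.2 (Nat.ceil_pos.2 (by positivity)).ne'
  have hD : ⌈2 / δ⌉₊ ≤ 3 * scale d δ ε := by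
    refine Nat.ceil_le.2 ?_
    push_cast
    rw [div_eq_mul_one_div]
    linarith
  set Y := scale d δ ε
  set D := ⌈2 / δ⌉₊
  have hsize : ∀ (M : ℕ) (i : Fin d) v, (writeOut D M i v).size ≤ 10 ^ 18 * Y ^ 6 := fun M i v => by
    have h₁ := size_writeOut_le (D := D) (M := M) i v
    have h₆ := Nat.le_self_pow (show 6 ≠ 0 by norm_num) Y
    omega
  by_cases htriv : d = 1 ∨ 1 < δ
  -- A fixed answer is good enough, and no calls are needed.
  · refine ⟨D, 0, fun i => writeOut D 0 i (if d = 1 then 1 else 1 / 2), 0, D + 1,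
      10 ^ 18 * Y ^ 6, 0, le_rfl, by simpa using hε.le, ?_, size_bound hY (by simp) hD hdY, ?_,
      fun i => hsize _ _ _, ?_⟩
    · have := Real.log_nonneg (show 1 ≤ d / ε by rw [le_div_iff₀ hε]; linarith)
      simp only [mul_zero, Nat.cast_zero]
      positivity
    · simpa using steps_bound hY (M := 0) (by simp) (k := 0) (by simp) (c := 0) (by simp) hD
        (J := 0) (by nlinarith) hdY
    · intro H _ _ φ U hφ
      refine ⟨fun i => (writeOut_reliable φ U i _).mono Set.subset_union_right le_rfl le_rfl, ?_⟩
      intro i n s _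
      refine (writeOut_not_missed φ U i ?_ n s).le.trans (by simp)
      split_ifs with h
      · subst h
        rw [hitProb_eq_one U hφ]
        have := abs_binary_digitsOf_sub_le D zero_le_one (le_refl (1 : ℝ))
        linarith
      · have h₁ := abs_binary_digitsOf_sub_le D (v := 1 / 2) (by norm_num) (by norm_num)
        have h₂ : (2⁻¹ : ℝ) ^ D ≤ 2⁻¹ ^ 1 := pow_le_pow_of_le_one (by norm_num) (by norm_num) hD₁
        have h₃ := abs_le.1 (h₁.trans h₂)
        have h₄ := hitProb_nonneg (φ := φ) U i
        have h₅ := hitProb_le_one U i hφ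
        have h₆ : 1 < δ := htriv.resolve_left h
        rw [abs_lt]
        constructor <;> linarith
  · push Not at htriv
    obtain ⟨hd₁, hδ₁⟩ := htriv
    -- the precision `Δ` of the angle and the rounding to `D` digits cost at most `δ / 2` each
    have hd₂ : (2 : ℝ) ≤ d := by exact_mod_cast (by have := NeZero.ne d; omega : 2 ≤ d)
    obtain ⟨J, Δ, hΔ, hΔδ, hΔδ', hJπ, hJ⟩ := exists_width hδ hδ₁
    set L := Real.log (d / ε) with hLdef
    have hL : 1 / 2 ≤ L := by
      have : Real.log 2 ≤ L := Real.log_le_log two_pos (by rw [le_div_iff₀ hε]; nlinarith)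
      linarith [Real.log_two_gt_d9]
    have hexp : Real.exp (-L) = ε / d := by
      rw [Real.exp_neg, Real.exp_log (by positivity), inv_div]
    have hJ' : 2 ^ J ≤ 16 * Y ^ 2 := by
      have : (2 : ℝ) ^ J ≤ 16 * (Y : ℝ) ^ 2 := hJ.trans (by gcongr)
      exact_mod_cast this
    have hM : repsOf L J ≤ 41000000 * Y ^ 2 := by
      have h₁ := repsOf_le hL J
      have h₂ : (J : ℝ) ≤ 16 * (Y : ℝ) ^ 2 := by exact_mod_cast Nat.lt_two_pow_self.le.trans hJ'
      have h₃ : (Y : ℝ) ≤ (Y : ℝ) ^ 2 := by exact_mod_cast Nat.le_self_pow two_ne_zero Y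
      exact_mod_cast (by linarith : (repsOf L J : ℝ) ≤ 41000000 * (Y : ℝ) ^ 2)
    have hk : ⌈2 / Δ⌉₊ ≤ 6 * Y := by
      refine Nat.ceil_le.2 ?_
      push_cast
      rw [div_le_iff₀ hΔ]
      rw [div_le_iff₀ hδ] at hδY
      nlinarith
    have hc : Nat.clog 2 d ≤ Y := (Nat.clog_le_of_le_pow Nat.lt_two_pow_self.le).trans hdY
    have hreps : ∀ j ≤ J, repsOf L j ≤ repsOf L J := fun j hj => repsOf_mono L hj
    have hl : 0 + Δ * (3 / 2) ^ J ≤ Real.pi / 3 := by rw [zero_add, hJπ]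
    refine ⟨D, repsOf L J, fun i => tree (counter d D _) i (repsOf L) Δ
      (fun l => writeOut D _ i (valueAt Δ l)) J 0, ⌊20 * 2359298 / Δ * (2 * L + 6)⌋₊,
      D + 1 + J * (repsOf L J + 4 + repsOf L J * (2 * roundSteps d ⌈2 / Δ⌉₊ + repsOf L J + 4)),
      10 ^ 18 * Y ^ 6, ε / d, by positivity, by field_simp; exact le_rfl, ?_,
      size_bound hY hM hD hdY, steps_bound hY hM hk hc hD hJ' hdY, fun i => ?_, ?_⟩
    · rw [Nat.cast_mul]
      refine (mul_le_mul_of_nonneg_left (Nat.floor_le (by positivity)) (by positivity)).trans ?_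
      have h₁ : 20 * 2359298 / Δ ≤ 20 * 2359298 / (δ / 3) := by gcongr
      calc (d : ℝ) * (20 * 2359298 / Δ * (2 * L + 6))
          ≤ d * (20 * 2359298 / (δ / 3) * (14 * L)) := by gcongr; linarith
        _ = 1981810320 * (d / δ * L) := by field_simp; norm_num
        _ ≤ 2 * 10 ^ 9 * (d / δ * L) := by gcongr; norm_num
    · have := size_tree_le (C := counter d D (repsOf L J)) (i := i) (reps := repsOf L) hΔ
        (leaf := fun l => writeOut D _ i (valueAt Δ l))
        (fun l => size_writeOut_le i _) J 0 le_rfl hl hreps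
      exact (Nat.le_add_right _ _).trans (this.trans (tree_size_bound hY hM hk hc hD hJ'))
    · intro H _ _ φ U hφ
      have hleaf : ∀ i l, Reliable φ U (writeOut D (repsOf L J) i (valueAt Δ l))
          (ownBits D _ i) 0 (D + 1) :=
        fun i l => (writeOut_reliable φ U i _).mono Set.subset_union_right le_rfl le_rfl
      refine ⟨fun i => ?_, fun i n s hs => ?_⟩
      · obtain ⟨A, B, h, hA, hB⟩ := tree_reliable (C := counter d D (repsOf L J)) (i := i) U hφ hΔ
          (S := ownBits D _ i) Set.subset_union_left (hleaf i) (κ := 2359298) (by norm_num)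
          (by linarith : (0 : ℝ) ≤ L) J 0 le_rfl hl hreps fun j _ => repsOf_le hL j
        refine h.mono subset_rfl (Nat.le_floor (hA.trans ?_)) hB
        gcongr
        have : (0 : ℝ) ≤ (2 / 3) ^ J * (2 * L + 2 * J + 6) := by positivity
        linarith
      · have h₁ := tree_error (C := counter d D (repsOf L J)) (i := i) U hφ hΔ
          (S := ownBits D _ i) Set.subset_union_left (hleaf i) (missed_le_one (hitProb φ U i) δ i)
          (fun l h h' n s _ => (writeOut_not_missed φ U i ?_ n s).le) (Real.exp_nonneg (-L)) J hreps
          (fun j _ => exp_repsOf_le L j) 0 le_rfl hl (angle_nonneg U i)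
          (by rw [zero_add, hJπ]; exact angle_le U i hφ) n s hs
        · refine h₁.trans ?_
          rw [hexp]
          have hw := s.weight_nonneg
          gcongr
          have : (0 : ℝ) ≤ ε / d * (1 / 2) ^ J := by positivity
          linarith
        · have h₁ := abs_binary_digitsOf_sub_le D (valueAt_nonneg Δ l) (valueAt_le_one Δ l)
          have h₂ := abs_valueAt_sub_hitProb_le U i hφ h h'
          have h₃ := abs_sub_le (binary (digitsOf D (valueAt Δ l))) (valueAt Δ l) (hitProb φ U i)
          linarith

end Programs

end QTomo

theorem theorem2 :
    ∃ (C K : ℝ) (s : ℕ),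
      ∀ (d : ℕ) [NeZero d] (δ ε : ℝ), 0 < δ → 0 < ε → ε < 1 →
        ∃ 𝒜 : Algorithm d,
          (𝒜.size : ℝ) ≤ K * (d + 1 / δ + Real.log (1 / ε)) ^ s ∧
          ∀ (H : Type*) [NormedAddCommGroup H] [InnerProductSpace ℂ H] [CompleteSpace H]
            (φ : H) (E : Fin d → H →L[ℂ] H) (U : Joint H d ≃ₗᵢ[ℂ] Joint H d),
            ‖φ‖ = 1 → IsPOVM E → Implements U E →
              𝒜.prob φ U {b | Undamaged φ b.vec} = 1 ∧
              ENNReal.ofReal (1 - ε) ≤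
                𝒜.prob φ U {b | ∀ i, |𝒜.estimate b.mem i - outcomeProb E φ i| < δ} ∧
              𝒜.expect φ U (fun b => (b.calls : ENNReal)) ≤
                ENNReal.ofReal (C * (d / δ * Real.log (d / ε))) ∧
              𝒜.expect φ U (fun b => (b.steps : ENNReal)) ≤
                ENNReal.ofReal (K * (d + 1 / δ + Real.log (1 / ε)) ^ s) := by
  refine ⟨2 * 10 ^ 9, 10 ^ 19 * 2 ^ 7, 7, fun d _ δ ε hδ hε hε' => ?_⟩
  obtain ⟨D, M, T, A, B, b, e, he, hde, hA, hsize, hB, hb, hT⟩ := exists_programs d hδ hε hε'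
  have hpoly : ((10 ^ 19 * scale d δ ε ^ 7 : ℕ) : ℝ) ≤
      10 ^ 19 * 2 ^ 7 * (d + 1 / δ + Real.log (1 / ε)) ^ 7 := by
    rw [mul_assoc, ← mul_pow, Nat.cast_mul, Nat.cast_pow (scale d δ ε)]
    exact mul_le_mul (by norm_num) (pow_le_pow_left₀ (Nat.cast_nonneg _) (scale_le hδ hε hε') 7)
      (by positivity) (by norm_num)
  refine ⟨assemble D M T, (Nat.cast_le.2 ((size_assemble_le T hb).trans hsize)).trans hpoly, ?_⟩
  intro H _ _ _ φ E U hφ _ hU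
  have hq : ∀ i, outcomeProb E φ i = hitProb φ U i := fun i => (hU φ i).symm
  obtain ⟨h₁, h₂⟩ := hT H φ U hφ
  obtain ⟨r₁, r₂, r₃, r₄⟩ := assemble_spec hφ h₁ he h₂
  refine ⟨r₁, ?_, r₃.trans (ENNReal.ofReal_le_ofReal hA),
    r₄.trans (ENNReal.ofReal_le_ofReal ((Nat.cast_le.2 hB).trans hpoly))⟩
  simp only [hq]
  exact (ENNReal.ofReal_le_ofReal (by linarith)).trans r₂
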